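/- Let $M=(S,\mathcal B)$ be a matroid of rank $r$ on a finite ground set $S$, with rank function $r_M$. For $x\in\mathbb R^S$ and $F\subseteq S$ write $x(F)=\sum_{e\in F}x_e$ and $H_F=\{x\in\mathbb R^S: x(F)=r_M(F)\}$. Let $P(M)\subseteq\mathbb R^S$ be the base polytope of $M$, that is, the convex hull of the indicator vectors of the bases, and let $Q(M)$ be the intersection of the affine span of $P(M)$ with the hypersimplex $\Delta(r,S)=\{x\in[0,1]^S: x(S)=r\}$. Call $F\subseteq S$ a *split facet set* if $P(M)\cap H_F$ is a facet of $P(M)$ and $H_F$ meets the relative interior of $Q(M)$. The matroid $M$ is a *split matroid* if for any two split facet sets $F,G$ with $P(M)\cap H_F\neq P(M)\cap H_G$, the hyperplanes $H_F$ and $H_G$ do not meet in the relative interior of $Q(M)$. Suppose that $M$ is a split matroid and that $S$ can be partitioned into two bases of $M$. Then $M$ is equitable: for every $X\subseteq S$ there is a basis $B$ of $M$ such that $S-B$ is also a basis and $$\left\lfloor \frac{|X|}{2}\right\rfloor\le |B\cap X|\le\left\lceil\frac{|X|}{2}\right\rceil .$$ -/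

import Mathlib

noncomputable section

namespace Matroid

variable {α : Type*}

/-- The rank of a set `F` in `M`, as a natural number. -/
def rkNat (M : Matroid α) (F : Set α) : ℕ := (M.eRk F).toNat

/-- The base polytope of `M`: the convex hull of the 0/1 indicator vectors of the bases of `M`. -/
def basePolytope (M : Matroid α) : Set (α → ℝ) :=
  convexHull ℝ {x | ∃ B, M.IsBase B ∧ x = B.indicator 1}

/-- The hypersimplex on the ground set of `M`, of the same rank as `M`, that is, the base polytope
of the uniform matroid with the ground set and the rank of `M`. -/
def hypersimplex (M : Matroid α) : Set (α → ℝ) :=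
  {x | (∀ e ∈ M.E, 0 ≤ x e ∧ x e ≤ 1) ∧ (∀ e ∉ M.E, x e = 0) ∧
    ∑ᶠ e ∈ M.E, x e = (M.rkNat M.E : ℝ)}

/-- The hypersimplex intersected with the affine span of the base polytope. This is the whole
hypersimplex if `M` is connected. -/
def ambientPolytope (M : Matroid α) : Set (α → ℝ) :=
  (affineSpan ℝ M.basePolytope : Set (α → ℝ)) ∩ M.hypersimplex

/-- The hyperplane `x(F) = r(F)`; the inequality `x(F) ≤ r(F)` is valid on the base polytope. -/
def rankHyperplane (M : Matroid α) (F : Set α) : Set (α → ℝ) :=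
  {x | ∑ᶠ e ∈ F, x e = (M.rkNat F : ℝ)}

/-- `F` defines a facet of the base polytope: the face in which the inequality `x(F) ≤ r(F)` is
tight is non-empty and has codimension one in the base polytope. -/
def IsFacetDefining (M : Matroid α) (F : Set α) : Prop :=
  F ⊆ M.E ∧ (M.basePolytope ∩ M.rankHyperplane F).Nonempty ∧
    Module.finrank ℝ (vectorSpan ℝ (M.basePolytope ∩ M.rankHyperplane F)) + 1 =
      Module.finrank ℝ (vectorSpan ℝ M.basePolytope)

/-- `F` defines a facet of the base polytope whose hyperplane cuts through the relative interior of
the ambient polytope. All edges of the ambient polytope are in directions `e_i - e_j`, so the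
integral hyperplane `x(F) = r(F)` cuts no edge in an inner point: it then splits the ambient
polytope into two pieces without new vertices. -/
def IsSplitFacet (M : Matroid α) (F : Set α) : Prop :=
  M.IsFacetDefining F ∧
    (M.rankHyperplane F ∩ intrinsicInterior ℝ M.ambientPolytope).Nonempty

/-- Split matroids (Joswig and Schröter): the splits defined by any two distinct facets of the base
polytope are compatible, that is, their hyperplanes do not meet in the relative interior of the
ambient polytope. (Different sets may define the same facet when `M` is disconnected.) -/
def IsSplit (M : Matroid α) : Prop :=
  ∀ F G : Set α, M.IsSplitFacet F → M.IsSplitFacet G →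
    M.basePolytope ∩ M.rankHyperplane F ≠ M.basePolytope ∩ M.rankHyperplane G →
    M.rankHyperplane F ∩ M.rankHyperplane G ∩ intrinsicInterior ℝ M.ambientPolytope = ∅

/-- Equitable matroids. The bounds are `⌊|X|/2⌋` and `⌈|X|/2⌉`. -/
def IsEquitable (M : Matroid α) : Prop :=
  ∀ X ⊆ M.E, ∃ B, M.IsBase B ∧ M.IsBase (M.E \ B) ∧
    X.ncard / 2 ≤ (B ∩ X).ncard ∧ (B ∩ X).ncard ≤ (X.ncard + 1) / 2

end Matroid

end

/-!
The facets of the base polytope of a connected matroid, apart from coordinate bounds, are given by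
the flacets `F`. A partition of the ground set into two bases gives `|K| = 2 r(K)` for each
connected component `K`. Suppose two flacets of `K` satisfy `|F ∩ G| + r(K) > r(F) + r(G)`. Then the
atoms of `F` and `G` carry constants strictly between `0` and `1` with `x(F) = r(F)`, `x(G) = r(G)`
and `x(K) = r(K)`. This is a common point of the two hyperplanes in the relative interior of the
ambient polytope. Hence `|F ∩ G| + r(K) ≤ r(F) + r(G)` in a split matroid.

Encode a set `B ⊆ K` by the sign vector `v` that is `1` on `B` and `-1` on `K \ B`. Both `B` and
`K \ B` are bases if and only if `|v(F)| ≤ 2 r(F) - |F|` for all flacets `F` and `v(K) = 0`. The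
inequality above leaves so much slack that a vector which is balanced on `X` and on `K \ X` and
violates the bound for some flacet can be moved to the boundary of this bound without violating
any other. The components are glued by choosing a base or its complement in each of them.
-/

namespace SplitMatroid

variable {α : Type*}

section SignVector

/-- A vector with entries `1` and `-1`. It encodes a bipartition of a set, and its sum over a set
is the imbalance of the bipartition there. -/
def IsSign (v : α → ℤ) : Prop := ∀ e, v e = 1 ∨ v e = -1

variable {ι : Type*} {K X F G : Finset α} {v : α → ℤ} {p q : α}

lemma IsSign.neg (hv : IsSign v) : IsSign (-v) := by
  intro e
  rcases hv e with h | h <;> simp [h]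

lemma IsSign.two_dvd_sum_sub_card (hv : IsSign v) (A : Finset α) :
    (2 : ℤ) ∣ ∑ e ∈ A, v e - A.card := by
  have h : ∑ e ∈ A, v e - A.card = ∑ e ∈ A, (v e - 1) := by simp
  rw [h]
  refine Finset.dvd_sum fun e _ => ?_
  rcases hv e with h | h <;> simp [h]

lemma IsSign.abs_sum_le_card (hv : IsSign v) (A : Finset α) : |∑ e ∈ A, v e| ≤ A.card := by
  refine (Finset.abs_sum_le_sum_abs v A).trans (le_of_eq ?_)
  rw [Finset.sum_congr rfl fun e _ => show |v e| = 1 by rcases hv e with h | h <;> simp [h]]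
  simp

lemma IsSign.exists_eq_one (hv : IsSign v) {A : Finset α} (h : 0 < ∑ e ∈ A, v e) :
    ∃ p ∈ A, v p = 1 := by
  obtain ⟨p, hp, hvp⟩ := Finset.exists_lt_of_sum_lt (f := fun _ => (0 : ℤ)) (by simpa using h)
  exact ⟨p, hp, (hv p).resolve_right (by omega)⟩

lemma IsSign.exists_eq_neg_one (hv : IsSign v) {A : Finset α} (h : ∑ e ∈ A, v e < 0) :
    ∃ p ∈ A, v p = -1 := by
  obtain ⟨p, hp, hvp⟩ := Finset.exists_lt_of_sum_lt (g := fun _ => (0 : ℤ)) (by simpa using h)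
  exact ⟨p, hp, (hv p).resolve_left (by omega)⟩

lemma exists_isSign_sum_eq {A : Finset α} {t : ℤ} (ht : |t| ≤ A.card)
    (hpar : (2 : ℤ) ∣ t - A.card) : ∃ v, IsSign v ∧ ∑ e ∈ A, v e = t := by
  classical
  obtain ⟨k, hk⟩ := hpar
  rw [abs_le] at ht
  obtain ⟨P, hPA, hP⟩ := Finset.exists_subset_card_eq (s := A) (n := (A.card + k).toNat) (by omega)
  refine ⟨fun e => if e ∈ P then 1 else -1, fun e => ite_eq_or_eq .., ?_⟩
  rw [← Finset.sum_sdiff hPA, Finset.sum_congr rfl fun e he => if_neg (Finset.mem_sdiff.1 he).2,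
    Finset.sum_congr rfl fun e he => if_pos he]
  have hcard := Finset.card_sdiff_add_card_eq_card hPA
  simp only [Finset.sum_const, nsmul_eq_mul]
  omega

lemma exists_isSign_forall_sum_fiber_eq [DecidableEq ι] (c : α → ι) (t : ι → ℤ)
    (ht : ∀ i, |t i| ≤ (K.filter (c · = i)).card)
    (hpar : ∀ i, (2 : ℤ) ∣ t i - (K.filter (c · = i)).card) :
    ∃ v, IsSign v ∧ ∀ i, ∑ e ∈ K with c e = i, v e = t i := by
  choose u hu hsum using fun i => exists_isSign_sum_eq (ht i) (hpar i)
  refine ⟨fun e => u (c e) e, fun e => hu (c e) e, fun i => ?_⟩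
  rw [← hsum i]
  refine Finset.sum_congr rfl fun e he => ?_
  simp only [(Finset.mem_filter.1 he).2]

variable [DecidableEq α]

lemma sum_comp_swap_of_mem_iff (h : p ∈ G ↔ q ∈ G) :
    ∑ e ∈ G, v (Equiv.swap p q e) = ∑ e ∈ G, v e := by
  refine Finset.sum_equiv (Equiv.swap p q) (fun e => ?_) fun _ _ => rfl
  rw [Equiv.swap_apply_def]
  split_ifs with h1 h2 <;> simp_all

lemma sum_comp_swap_of_notMem_of_mem (hp : p ∉ G) (hq : q ∈ G) :
    ∑ e ∈ G, v (Equiv.swap p q e) = ∑ e ∈ G, v e + v p - v q := by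
  rw [← Finset.add_sum_erase G _ hq, ← Finset.add_sum_erase G v hq, Equiv.swap_apply_right,
    Finset.sum_congr rfl fun e he => ?_]
  · ring
  · rw [Equiv.swap_apply_of_ne_of_ne (ne_of_mem_of_not_mem (Finset.mem_of_mem_erase he) hp)
      (Finset.ne_of_mem_erase he)]

lemma IsSign.exists_exchange [Fintype ι] [DecidableEq ι] (hv : IsSign v) (c : α → ι) (hG : G ⊆ K)
    (h : ∑ e ∈ G, v e < ∑ i, min 0 (∑ e ∈ K with c e = i, v e)) :
    ∃ p ∈ K \ G, ∃ q ∈ G, c p = c q ∧ v p = 1 ∧ v q = -1 := by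
  rw [← Finset.sum_fiberwise G c v] at h
  obtain ⟨i, -, hi⟩ := Finset.exists_lt_of_sum_lt h
  have hsplit := Finset.sum_sdiff (f := v) (Finset.filter_subset_filter (c · = i) hG)
  rw [lt_min_iff] at hi
  obtain ⟨q, hq, hvq⟩ := hv.exists_eq_neg_one hi.1
  obtain ⟨p, hp, hvp⟩ := hv.exists_eq_one
    (A := K.filter (c · = i) \ G.filter (c · = i)) (by omega)
  simp only [Finset.mem_sdiff, Finset.mem_filter] at hp hq
  exact ⟨p, Finset.mem_sdiff.2 ⟨hp.1.1, fun hpG => hp.2 ⟨hpG, hp.1.2⟩⟩, q, hq.1,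
    hp.1.2.trans hq.2.symm, hvp, hvq⟩

omit [DecidableEq α] in
lemma IsSign.exists_sum_eq_and_sum_fiber_eq [Fintype ι] [DecidableEq ι] (hv : IsSign v)
    (c : α → ι) (hG : G ⊆ K) {m : ℤ} (hvm : ∑ e ∈ G, v e ≤ m)
    (hm : m ≤ ∑ i, min 0 (∑ e ∈ K with c e = i, v e)) (hpar : (2 : ℤ) ∣ m - ∑ e ∈ G, v e) :
    ∃ w, IsSign w ∧ (∀ i, ∑ e ∈ K with c e = i, w e = ∑ e ∈ K with c e = i, v e) ∧
      ∑ e ∈ G, w e = m := by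
  classical
  obtain ⟨k, hk⟩ := hpar
  lift k to ℕ using by omega
  induction k generalizing v with
  | zero => exact ⟨v, hv, fun _ => rfl, by omega⟩
  | succ k ih =>
    obtain ⟨p, hp, q, hq, hpq, hvp, hvq⟩ := hv.exists_exchange c hG (by omega)
    rw [Finset.mem_sdiff] at hp
    have hfib : ∀ i, ∑ e ∈ K with c e = i, v (Equiv.swap p q e) = ∑ e ∈ K with c e = i, v e :=
      fun i => sum_comp_swap_of_mem_iff (by simp [hp.1, hG hq, hpq])
    have hsum := sum_comp_swap_of_notMem_of_mem (v := v) hp.2 hq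
    obtain ⟨w, hw, hwfib, hwm⟩ := ih (v := fun e => v (Equiv.swap p q e)) (fun e => hv _)
      (by omega) (by simpa only [hfib] using hm) (by push_cast at hk; omega)
    exact ⟨w, hw, fun i => (hwfib i).trans (hfib i), hwm⟩

/-- The pair of truth values of `e ∈ X` and `e ∈ F`; its fibres are the atoms of `X` and `F`. -/
def atomOf (X F : Finset α) (e : α) : Bool × Bool := (decide (e ∈ X), decide (e ∈ F))

lemma sum_eq_sum_atomOf (hX : X ⊆ K) (hF : F ⊆ K) (v : α → ℤ) :
    ∑ e ∈ X, v e = ∑ e ∈ K with atomOf X F e = (true, true), v e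
        + ∑ e ∈ K with atomOf X F e = (true, false), v e ∧
      ∑ e ∈ K \ X, v e = ∑ e ∈ K with atomOf X F e = (false, true), v e
        + ∑ e ∈ K with atomOf X F e = (false, false), v e ∧
      ∑ e ∈ F, v e = ∑ e ∈ K with atomOf X F e = (true, true), v e
        + ∑ e ∈ K with atomOf X F e = (false, true), v e := by
  have hsum {A B C : Finset α} (h : B ∪ C = A) (hd : Disjoint B C) :
      ∑ e ∈ A, v e = ∑ e ∈ B, v e + ∑ e ∈ C, v e := by rw [← h, Finset.sum_union hd]
  have hdisj {i j : Bool × Bool} (hij : i ≠ j) :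
      Disjoint (K.filter (atomOf X F · = i)) (K.filter (atomOf X F · = j)) :=
    Finset.disjoint_filter.2 fun e _ hi hj => hij (hi.symm.trans hj)
  refine ⟨hsum ?_ (hdisj (by simp)), hsum ?_ (hdisj (by simp)), hsum ?_ (hdisj (by simp))⟩ <;>
  · ext e
    have := @hX e
    have := @hF e
    simp only [atomOf, Finset.mem_union, Finset.mem_filter, Finset.mem_sdiff, Prod.mk.injEq,
      decide_eq_true_eq, decide_eq_false_iff_not]
    tauto

/-- A sign vector with zero sum on `X` and on `K \ X`. It encodes a bipartition of `K` that bisects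
both `X` and its complement. -/
structure IsBalanced (K X : Finset α) (v : α → ℤ) : Prop where
  isSign : IsSign v
  sum_left : ∑ e ∈ X, v e = 0
  sum_right : ∑ e ∈ K \ X, v e = 0

lemma IsBalanced.neg (hv : IsBalanced K X v) : IsBalanced K X (-v) :=
  ⟨hv.isSign.neg, by simp [hv.sum_left], by simp [hv.sum_right]⟩

lemma IsBalanced.sum_ground (hv : IsBalanced K X v) (hX : X ⊆ K) : ∑ e ∈ K, v e = 0 := by
  rw [← Finset.sum_sdiff hX, hv.sum_left, hv.sum_right, add_zero]

lemma exists_isBalanced_of_even (h1 : Even X.card) (h2 : Even (K \ X).card) :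
    ∃ v, IsBalanced K X v := by
  obtain ⟨u, hu, hsumu⟩ := exists_isSign_sum_eq (A := X) (t := 0) (by simp)
    (by have := h1.two_dvd; omega)
  obtain ⟨w, hw, hsumw⟩ := exists_isSign_sum_eq (A := K \ X) (t := 0) (by simp)
    (by have := h2.two_dvd; omega)
  refine ⟨fun e => if e ∈ X then u e else w e, fun e => ?_, ?_, ?_⟩
  · split_ifs
    exacts [hu e, hw e]
  · rw [← hsumu]
    exact Finset.sum_congr rfl fun e he => if_pos he
  · rw [← hsumw]
    exact Finset.sum_congr rfl fun e he => if_neg (Finset.mem_sdiff.1 he).2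

lemma exists_abs_le_abs_and_add_eq {a b s : ℤ} (hs : 0 ≤ s) (hle : s ≤ a + b)
    (hpar : (2 : ℤ) ∣ a + b - s) :
    ∃ a' b', |a'| ≤ |a| ∧ (2 : ℤ) ∣ a' - a ∧ |b'| ≤ |b| ∧ (2 : ℤ) ∣ b' - b ∧ a' + b' = s ∧
      (s = 0 ∨ 0 ≤ a' ∧ 0 ≤ b') := by
  rcases hs.eq_or_lt with rfl | hpos
  · exact ⟨a % 2, -(a % 2), by grind, by omega, by grind, by omega, by omega, Or.inl rfl⟩
  · rcases le_total |a| (s - b % 2) with h | h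
    · exact ⟨|a|, s - |a|, by grind, by grind, by grind, by grind, by grind, by grind⟩
    · exact ⟨s - b % 2, b % 2, by grind, by grind, by grind, by grind, by grind, by grind⟩

lemma IsBalanced.exists_sum_eq (hv : IsBalanced K X v) (hX : X ⊆ K) (hF : F ⊆ K) {s : ℤ}
    (hs : 0 ≤ s) (hle : s ≤ ∑ e ∈ F, v e) (hpar : (2 : ℤ) ∣ ∑ e ∈ F, v e - s) :
    ∃ w, IsBalanced K X w ∧ ∑ e ∈ F, w e = s ∧
      (s = 0 ∨ -s ≤ ∑ i, min 0 (∑ e ∈ K with atomOf X F e = i, w e)) := by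
  obtain ⟨hvX, hvKX, hvF⟩ := sum_eq_sum_atomOf hX hF v
  have hX0 := hv.sum_left
  have hKX0 := hv.sum_right
  obtain ⟨a, b, ha, hapar, hb, hbpar, hab, hnonneg⟩ := exists_abs_le_abs_and_add_eq hs
    (hle.trans_eq hvF) (by rwa [← hvF])
  let t : Bool × Bool → ℤ
    | (true, true) => a
    | (true, false) => -a
    | (false, true) => b
    | (false, false) => -b
  obtain ⟨w, hw, hwt⟩ := exists_isSign_forall_sum_fiber_eq (K := K) (atomOf X F) t
    (by
      rintro ⟨_ | _, _ | _⟩ <;>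
      · refine le_trans ?_ (hv.isSign.abs_sum_le_card _)
        simp only [t]
        grind)
    (by
      rintro ⟨_ | _, _ | _⟩ <;>
      · have := hv.isSign.two_dvd_sum_sub_card
        simp only [t]
        grind)
  obtain ⟨hwX, hwKX, hwF⟩ := sum_eq_sum_atomOf hX hF w
  simp only [hwt, t] at hwX hwKX hwF
  refine ⟨w, ⟨hw, by omega, by omega⟩, by omega, hnonneg.imp_right fun ⟨_, _⟩ => ?_⟩
  simp only [hwt, Fintype.sum_prod_type, Fintype.sum_bool, t]
  omega

/-- A family of subsets of `K` with slacks `s`, any two of which are nearly complementary in `K`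
compared with the slacks. In the application it consists of the flacets of a matroid of rank
function `r` on `K`, with `s F = 2 * r F - |F|`. -/
structure IsSlackFamily (K : Finset α) (H : Set (Finset α)) (s : Finset α → ℤ) : Prop where
  subset : ∀ F ∈ H, F ⊆ K
  nonneg : ∀ F ∈ H, 0 ≤ s F
  parity : ∀ F ∈ H, (2 : ℤ) ∣ s F - F.card
  card_le : ∀ F ∈ H, ∀ G ∈ H, F ≠ G → ((F ∩ G).card + (K \ (F ∪ G)).card : ℤ) ≤ s F + s G

namespace IsSlackFamily

variable {H : Set (Finset α)} {s : Finset α → ℤ}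

lemma sum_add_sum_le (hH : IsSlackFamily K H s) (hX : X ⊆ K) (hv : IsBalanced K X v)
    (hF : F ∈ H) (hG : G ∈ H) (hFG : F ≠ G) :
    ∑ e ∈ F, v e + ∑ e ∈ G, v e ≤ s F + s G := by
  have hinter := hv.isSign.abs_sum_le_card (F ∩ G)
  have hcompl := hv.isSign.abs_sum_le_card (K \ (F ∪ G))
  have hground := hv.sum_ground hX
  rw [← Finset.sum_sdiff (Finset.union_subset (hH.subset F hF) (hH.subset G hG))] at hground
  have hunion := Finset.sum_union_inter (f := v) (s₁ := F) (s₂ := G)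
  have hle := hH.card_le F hF G hG hFG
  rw [abs_le] at hinter hcompl
  omega

lemma neg_le_sum_add_sum (hH : IsSlackFamily K H s) (hX : X ⊆ K) (hv : IsBalanced K X v)
    (hF : F ∈ H) (hG : G ∈ H) (hFG : F ≠ G) :
    -(s F + s G) ≤ ∑ e ∈ F, v e + ∑ e ∈ G, v e := by
  have h := hH.sum_add_sum_le hX hv.neg hF hG hFG
  simp only [Pi.neg_apply, Finset.sum_neg_distrib] at h
  omega

lemma two_dvd_sum_sub (hH : IsSlackFamily K H s) (hv : IsSign v) (hF : F ∈ H) :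
    (2 : ℤ) ∣ ∑ e ∈ F, v e - s F := by
  have h1 := hv.two_dvd_sum_sub_card F
  have h2 := hH.parity F hF
  omega

lemma exists_isBalanced_forall_abs_sum_le_of_lt (hH : IsSlackFamily K H s) (hX : X ⊆ K)
    (hv : IsBalanced K X v) (hF : F ∈ H) (hlt : s F < ∑ e ∈ F, v e)
    (hmin : ∀ w, IsBalanced K X w → ∀ G ∈ H, s G < |∑ e ∈ G, w e| → s F ≤ s G) :
    ∃ w, IsBalanced K X w ∧ ∀ G ∈ H, |∑ e ∈ G, w e| ≤ s G := by
  have hF0 := hH.nonneg F hF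
  obtain ⟨w, hw, hwF, hwmin⟩ := hv.exists_sum_eq hX (hH.subset F hF) hF0 hlt.le
    (hH.two_dvd_sum_sub hv.isSign hF)
  by_contra! hcon
  obtain ⟨G, hG, hwG⟩ := hcon w hw
  have hFG : F ≠ G := by
    rintro rfl
    rw [hwF, abs_of_nonneg hF0] at hwG
    exact hwG.false
  have hsFG := hmin w hw G hG hwG
  have hadd := hH.sum_add_sum_le hX hw hF hG hFG
  have hadd' := hH.neg_le_sum_add_sum hX hw hF hG hFG
  have hwG' : ∑ e ∈ G, w e < -s G := by
    rcases lt_abs.1 hwG with h | h <;> omega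
  obtain ⟨u, hu, hufib, huG⟩ := hw.isSign.exists_sum_eq_and_sum_fiber_eq (atomOf X F)
    (hH.subset G hG) hwG'.le (by omega) (by have := hH.two_dvd_sum_sub hw.isSign hG; omega)
  obtain ⟨hwX, hwKX, hwF'⟩ := sum_eq_sum_atomOf hX (hH.subset F hF) w
  obtain ⟨huX, huKX, huF⟩ := sum_eq_sum_atomOf hX (hH.subset F hF) u
  simp only [hufib, ← hwX, ← hwKX, ← hwF', hw.sum_left, hw.sum_right, hwF] at huX huKX huF
  have hu' : IsBalanced K X u := ⟨hu, huX, huKX⟩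
  obtain ⟨J, hJ, huJ⟩ := hcon u hu'
  have hFJ : F ≠ J := by
    rintro rfl
    rw [huF, abs_of_nonneg hF0] at huJ
    exact huJ.false
  have hGJ : G ≠ J := by
    rintro rfl
    rw [huG, abs_neg, abs_of_nonneg (hH.nonneg G hG)] at huJ
    exact huJ.false
  have hle := hH.sum_add_sum_le hX hu' hF hJ hFJ
  have hge := hH.neg_le_sum_add_sum hX hu' hG hJ hGJ
  rcases lt_abs.1 huJ with h | h <;> omega

theorem exists_isBalanced_forall_abs_sum_le (hH : IsSlackFamily K H s) (hX : X ⊆ K)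
    (h1 : Even X.card) (h2 : Even (K \ X).card) :
    ∃ v, IsBalanced K X v ∧ ∀ F ∈ H, |∑ e ∈ F, v e| ≤ s F := by
  by_contra! hcon
  let V : Set (Finset α) := {F ∈ H | ∃ v, IsBalanced K X v ∧ s F < |∑ e ∈ F, v e|}
  have hV : V.Nonempty := by
    obtain ⟨v, hv⟩ := exists_isBalanced_of_even h1 h2
    obtain ⟨F, hF, hlt⟩ := hcon v hv
    exact ⟨F, hF, v, hv, hlt⟩
  obtain ⟨F, ⟨hF, v, hv, hlt⟩, hmin⟩ :=
    exists_minimalFor_of_wellFoundedLT (· ∈ V) (fun F => (s F).toNat) hV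
  have hmin' : ∀ w, IsBalanced K X w → ∀ G ∈ H, s G < |∑ e ∈ G, w e| → s F ≤ s G := by
    intro w hw G hG hlt
    have := hH.nonneg F hF
    have := hH.nonneg G hG
    have := hmin (j := G) ⟨hG, w, hw, hlt⟩
    simp only at this
    omega
  obtain ⟨v', hv', hlt'⟩ : ∃ v', IsBalanced K X v' ∧ s F < ∑ e ∈ F, v' e := by
    rcases lt_abs.1 hlt with h | h
    · exact ⟨v, hv, h⟩
    · exact ⟨-v, hv.neg, by simpa using h⟩
  obtain ⟨w, hw, hle⟩ := hH.exists_isBalanced_forall_abs_sum_le_of_lt hX hv' hF hlt' hmin'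
  obtain ⟨G, hG, hlt⟩ := hcon w hw
  exact (hle G hG).not_gt hlt

end IsSlackFamily

end SignVector

open scoped Matroid

variable {M : Matroid α} {A B C D F I J K X Y : Set α}

section Rank

lemma ncard_inter_add_ncard_inter_sdiff (hB : B.Finite) (h : X ⊆ Y) :
    (B ∩ X).ncard + (B ∩ (Y \ X)).ncard = (B ∩ Y).ncard := by
  rw [← Set.ncard_union_eq (by grind) (hB.inter_of_left X) (hB.inter_of_left _),
    ← Set.inter_union_distrib_left, Set.union_sdiff_cancel h]

lemma rkNat_empty (M : Matroid α) : M.rkNat ∅ = 0 := by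
  simp [Matroid.rkNat]

lemma rkNat_restrict (M : Matroid α) (h : X ⊆ K) : (M ↾ K).rkNat X = M.rkNat X := by
  rw [Matroid.rkNat, M.restrict_eRk_eq h, Matroid.rkNat]

lemma rkNat_restrict_ground (M : Matroid α) (K : Set α) :
    (M ↾ K).rkNat (M ↾ K).E = M.rkNat K :=
  rkNat_restrict M subset_rfl

lemma eRk_contract_add_eRk (M : Matroid α) (C X : Set α) :
    (M ／ C).eRk X + M.eRk C = M.eRk (X ∪ C) := by
  obtain ⟨I, hI⟩ := M.exists_isBasis' C
  obtain ⟨J, hJ⟩ := (M ／ C).exists_isBasis' X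
  obtain ⟨hJI, hdisj⟩ := hI.contract_indep_iff.1 hJ.indep
  have hspan : (X ∪ C) ∩ M.E ⊆ M.closure (J ∪ C) := by
    rintro e ⟨he, heE⟩
    by_cases heC : e ∈ C
    · exact M.mem_closure_of_mem' (Or.inr heC) heE
    · have heJ : e ∈ (M ／ C).closure J :=
        hJ.closure_eq_closure ▸ (M ／ C).mem_closure_of_mem' (he.resolve_right heC) ⟨heE, heC⟩
      rw [Matroid.contract_closure_eq] at heJ
      exact heJ.1
  have hunion : M.eRk (J ∪ C) = M.eRk (X ∪ C) := by
    refine (M.eRk_mono (Set.union_subset_union_left C hJ.subset)).antisymm ?_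
    rw [← M.eRk_inter_ground, ← M.eRk_closure_eq (J ∪ C)]
    exact M.eRk_mono hspan
  rw [← hunion, Set.union_comm, ← hI.eRk_eq_eRk_union J, Set.union_comm, hJI.eRk_eq_encard,
    Set.encard_union_eq (hdisj.symm.mono_right hI.subset), hI.encard_eq_eRk, hJ.encard_eq_eRk]

lemma ncard_eq_rkNat_of_isBasis (hI : M.IsBasis I X) : I.ncard = M.rkNat X := by
  rw [Matroid.rkNat, ← hI.encard_eq_eRk, Set.ncard_def]

lemma ncard_eq_rkNat_of_isBase (hB : M.IsBase B) : B.ncard = M.rkNat M.E :=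
  ncard_eq_rkNat_of_isBasis hB.isBasis_ground

lemma ncard_eq_rkNat_of_indep (hI : M.Indep I) : I.ncard = M.rkNat I :=
  ncard_eq_rkNat_of_isBasis hI.isBasis_self

variable [M.RankFinite]

lemma coe_rkNat (M : Matroid α) [M.RankFinite] (X : Set α) : (M.rkNat X : ℕ∞) = M.eRk X :=
  ENat.natCast_toNat (M.eRk_lt_top_iff.2 (Matroid.RankFinite.isRkFinite X)).ne

lemma rkNat_contract_add_rkNat (M : Matroid α) [M.RankFinite] (C X : Set α) :
    (M ／ C).rkNat X + M.rkNat C = M.rkNat (X ∪ C) := by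
  have h := eRk_contract_add_eRk M C X
  simp only [← coe_rkNat] at h
  exact_mod_cast h

lemma rkNat_mono (h : X ⊆ Y) : M.rkNat X ≤ M.rkNat Y := by
  have := M.eRk_mono h
  rw [← coe_rkNat, ← coe_rkNat] at this
  exact_mod_cast this

lemma rkNat_inter_add_rkNat_union_le (M : Matroid α) [M.RankFinite] (X Y : Set α) :
    M.rkNat (X ∩ Y) + M.rkNat (X ∪ Y) ≤ M.rkNat X + M.rkNat Y := by
  have := M.eRk_inter_add_eRk_union_le X Y
  simp only [← coe_rkNat] at this
  exact_mod_cast this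

lemma rkNat_le_rkNat_add_rkNat_sdiff (M : Matroid α) [M.RankFinite] (h : X ⊆ Y) :
    M.rkNat Y ≤ M.rkNat X + M.rkNat (Y \ X) := by
  have := rkNat_inter_add_rkNat_union_le M X (Y \ X)
  rw [Set.union_sdiff_cancel h] at this
  omega

lemma ncard_inter_le_rkNat (hI : M.Indep I) (X : Set α) : (I ∩ X).ncard ≤ M.rkNat X := by
  rw [ncard_eq_rkNat_of_indep (hI.subset Set.inter_subset_left)]
  exact rkNat_mono Set.inter_subset_right

lemma indep_of_ncard_le_rkNat (hX : X.Finite) (h : X.ncard ≤ M.rkNat X) : M.Indep X := by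
  refine (Matroid.RankFinite.isRkFinite X).indep_of_encard_le_eRk ?_
  rw [← coe_rkNat, ← hX.cast_ncard_eq]
  exact_mod_cast h

lemma isBasis_of_ncard_eq_rkNat (hI : M.Indep I) (hIX : I ⊆ X) (hX : X ⊆ M.E)
    (h : I.ncard = M.rkNat X) : M.IsBasis I X := by
  refine hI.isBasis_of_eRk_ge hI.finite hIX ?_ hX
  rw [← coe_rkNat, ← coe_rkNat, ← ncard_eq_rkNat_of_indep hI, h]

lemma isBase_of_ncard_eq_rkNat (hI : M.Indep I) (h : I.ncard = M.rkNat M.E) : M.IsBase I :=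
  Matroid.isBasis_ground_iff.1 (isBasis_of_ncard_eq_rkNat hI hI.subset_ground subset_rfl h)

lemma isBase_union_of_isBase_restrict_of_isBase_contract (hI : (M ↾ F).IsBase I)
    (hJ : (M ／ F).IsBase J) (hF : F ⊆ M.E) : M.IsBase (I ∪ J) := by
  have hIF : M.IsBasis I F := Matroid.isBase_restrict_iff hF |>.1 hI
  have hdisj : Disjoint F J := by have := hJ.subset_ground; grind [Matroid.contract_ground]
  refine isBase_of_ncard_eq_rkNat ?_ ?_
  · rw [Set.union_comm]
    exact (hIF.contract_indep_iff_of_disjoint hdisj).1 hJ.indep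
  · have hrk := rkNat_contract_add_rkNat M F (M.E \ F)
    rw [Set.sdiff_union_of_subset hF] at hrk
    rw [Set.ncard_union_eq (hdisj.mono_left hIF.subset) hI.indep.of_restrict.finite
      hJ.indep.of_contract.finite, ncard_eq_rkNat_of_isBasis hIF, ncard_eq_rkNat_of_isBase hJ,
      Matroid.contract_ground]
    omega

end Rank

section Tight

/-- The members of `B` in `A` span `A`, provided that `B` is independent. -/
def IsTight (M : Matroid α) (B A : Set α) : Prop := (B ∩ A).ncard = M.rkNat A

variable [M.RankFinite]

lemma exists_isBase_isTight_isTight (hAC : A ⊆ C) (hC : C ⊆ M.E) :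
    ∃ B, M.IsBase B ∧ IsTight M B A ∧ IsTight M B C := by
  obtain ⟨I, hI⟩ := M.exists_isBasis A (hAC.trans hC)
  obtain ⟨J, hJ, hIJ⟩ := hI.indep.subset_isBasis_of_subset (hI.subset.trans hAC) hC
  obtain ⟨B, hB, hJB⟩ := hJ.indep.exists_isBase_superset
  refine ⟨B, hB, ?_, ?_⟩
  · refine (ncard_inter_le_rkNat hB.indep A).antisymm ?_
    rw [← ncard_eq_rkNat_of_isBasis hI]
    exact Set.ncard_le_ncard (Set.subset_inter (hIJ.trans hJB) hI.subset)
      (hB.finite.inter_of_left A)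
  · refine (ncard_inter_le_rkNat hB.indep C).antisymm ?_
    rw [← ncard_eq_rkNat_of_isBasis hJ]
    exact Set.ncard_le_ncard (Set.subset_inter hJB hJ.subset) (hB.finite.inter_of_left C)

lemma exists_exchange_of_not_isTight (hB : M.IsBase B) (hA : A ⊆ M.E) (hBA : ¬ IsTight M B A) :
    ∃ f ∈ A \ B, ∃ e ∈ B \ A, M.IsBase (insert f (B \ {e})) := by
  obtain ⟨J, hJ⟩ := M.exists_isBasis A hA
  have hlt : (B ∩ A).encard < J.encard := by
    rw [← (hB.finite.inter_of_left A).cast_ncard_eq, ← hJ.indep.finite.cast_ncard_eq,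
      ncard_eq_rkNat_of_isBasis hJ]
    exact_mod_cast (ncard_inter_le_rkNat hB.indep A).lt_of_ne hBA
  obtain ⟨f, hf, hfI⟩ :=
    (hB.indep.subset Set.inter_subset_left).exists_insert_of_encard_lt hJ.indep hlt
  have hfA := hJ.subset hf.1
  obtain ⟨B', hB', hsub, hB'sub⟩ := hfI.exists_isBase_subset_union_isBase hB
  have hfB : f ∉ B := fun hfB => hf.2 ⟨hfB, hfA⟩
  obtain ⟨e, heB, heB'⟩ : ∃ e ∈ B, e ∉ B' := by
    by_contra! hBB'
    exact hfB (hB.eq_of_subset_isBase hB' hBB' ▸ hsub (Set.mem_insert f _))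
  have heA : e ∉ A := fun heA => heB' (hsub (Set.mem_insert_of_mem _ ⟨heB, heA⟩))
  have hB'ex : B' ⊆ insert f (B \ {e}) := by grind
  have hB'eq : B' = insert f (B \ {e}) := by
    refine Set.eq_of_subset_of_ncard_le hB'ex ?_ (hB.finite.sdiff.insert f)
    rw [Set.ncard_exchange hfB heB, ncard_eq_rkNat_of_isBase hB, ncard_eq_rkNat_of_isBase hB']
  exact ⟨f, ⟨hfA, hfB⟩, e, ⟨heB, heA⟩, hB'eq ▸ hB'⟩

end Tight

section Separator

/-- A union of connected components of `M`, in terms of the rank function. -/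
def IsSeparator (M : Matroid α) (A : Set α) : Prop :=
  A ⊆ M.E ∧ M.rkNat A + M.rkNat (M.E \ A) = M.rkNat M.E

/-- A matroid that is not a direct sum in a nontrivial way. The empty matroid counts as
connected. -/
def IsConnected (M : Matroid α) : Prop := ∀ A, IsSeparator M A → A = ∅ ∨ A = M.E

lemma IsSeparator.compl (hK : IsSeparator M K) : IsSeparator M (M.E \ K) := by
  refine ⟨Set.sdiff_subset, ?_⟩
  rw [Set.sdiff_sdiff_cancel_left hK.1, add_comm, hK.2]

lemma isSeparator_ground (M : Matroid α) : IsSeparator M M.E := by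
  simp [IsSeparator, rkNat_empty]

lemma isSeparator_restrict_iff :
    IsSeparator (M ↾ K) A ↔ A ⊆ K ∧ M.rkNat A + M.rkNat (K \ A) = M.rkNat K := by
  rw [IsSeparator, rkNat_restrict_ground, Matroid.restrict_ground_eq]
  refine and_congr_right fun hA => ?_
  rw [rkNat_restrict M hA, rkNat_restrict M Set.sdiff_subset]

variable [M.RankFinite]

lemma isSeparator_of_le (hK : K ⊆ M.E) (h : M.rkNat K + M.rkNat (M.E \ K) ≤ M.rkNat M.E) :
    IsSeparator M K :=
  ⟨hK, h.antisymm (rkNat_le_rkNat_add_rkNat_sdiff M hK)⟩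

lemma isSeparator_of_isTight (hA : A ⊆ M.E) (hB : M.IsBase B)
    (hBA : IsTight M B A) (hBA' : IsTight M B (M.E \ A)) : IsSeparator M A := by
  refine ⟨hA, ?_⟩
  rw [← hBA, ← hBA', ncard_inter_add_ncard_inter_sdiff hB.finite hA,
    Set.inter_eq_left.2 hB.subset_ground, ncard_eq_rkNat_of_isBase hB]

lemma isSeparator_contract_iff (hF : F ⊆ M.E) :
    IsSeparator (M ／ F) A ↔
      A ⊆ M.E \ F ∧ M.rkNat (A ∪ F) + M.rkNat (M.E \ A) = M.rkNat F + M.rkNat M.E := by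
  rw [IsSeparator, Matroid.contract_ground]
  refine and_congr_right fun hA => ?_
  have hrkA := rkNat_contract_add_rkNat M F A
  have hrkcompl := rkNat_contract_add_rkNat M F ((M.E \ F) \ A)
  have hrkground := rkNat_contract_add_rkNat M F (M.E \ F)
  rw [show (M.E \ F) \ A ∪ F = M.E \ A by grind] at hrkcompl
  rw [Set.sdiff_union_of_subset hF] at hrkground
  omega

lemma IsSeparator.isTight (hK : IsSeparator M K) (hB : M.IsBase B) : IsTight M B K := by
  have hle := ncard_inter_le_rkNat hB.indep K
  have hle' := ncard_inter_le_rkNat hB.indep (M.E \ K)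
  have hadd := ncard_inter_add_ncard_inter_sdiff hB.finite hK.1
  rw [Set.inter_eq_left.2 hB.subset_ground, ncard_eq_rkNat_of_isBase hB, ← hK.2] at hadd
  unfold IsTight
  omega

lemma IsSeparator.isBase_inter (hK : IsSeparator M K) (hB : M.IsBase B) :
    (M ↾ K).IsBase (B ∩ K) :=
  (Matroid.isBase_restrict_iff hK.1).2 <| isBasis_of_ncard_eq_rkNat
    (hB.indep.subset Set.inter_subset_left) Set.inter_subset_right hK.1 (hK.isTight hB)

lemma IsSeparator.isBase_union (hK : IsSeparator M K) (hI : (M ↾ K).IsBase I)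
    (hJ : (M ↾ (M.E \ K)).IsBase J) : M.IsBase (I ∪ J) := by
  rw [Matroid.isBase_restrict_iff hK.1] at hI
  rw [Matroid.isBase_restrict_iff Set.sdiff_subset] at hJ
  have hfin := hI.indep.finite.union hJ.indep.finite
  have hcard : (I ∪ J).ncard ≤ M.rkNat M.E := by
    rw [← hK.2, ← ncard_eq_rkNat_of_isBasis hI, ← ncard_eq_rkNat_of_isBasis hJ]
    exact Set.ncard_union_le I J
  have hrk : M.rkNat (I ∪ J) = M.rkNat M.E := by
    rw [Matroid.rkNat, hI.eRk_eq_eRk_union, Set.union_comm, hJ.eRk_eq_eRk_union,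
      Set.sdiff_union_of_subset hK.1, Matroid.rkNat]
  have hindep := indep_of_ncard_le_rkNat hfin (hcard.trans_eq hrk.symm)
  exact isBase_of_ncard_eq_rkNat hindep ((ncard_eq_rkNat_of_indep hindep).trans hrk)

lemma IsSeparator.inter (hA : IsSeparator M A) (hF : F ⊆ M.E) : IsSeparator (M ↾ F) (A ∩ F) := by
  rw [isSeparator_restrict_iff]
  refine ⟨Set.inter_subset_right, le_antisymm ?_ ?_⟩
  · have hinter := rkNat_inter_add_rkNat_union_le M A F
    have hcompl := rkNat_inter_add_rkNat_union_le M (A ∪ F) (M.E \ A)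
    rw [show (A ∪ F) ∩ (M.E \ A) = F \ (A ∩ F) by grind,
      show A ∪ F ∪ (M.E \ A) = M.E by grind [hA.1], ← hA.2] at hcompl
    omega
  · exact rkNat_le_rkNat_add_rkNat_sdiff M Set.inter_subset_right

lemma IsSeparator.of_restrict (hK : IsSeparator M K) (hA : IsSeparator (M ↾ K) A) :
    IsSeparator M A := by
  rw [isSeparator_restrict_iff] at hA
  refine isSeparator_of_le (hA.1.trans hK.1) ?_
  have hle := rkNat_le_rkNat_add_rkNat_sdiff M (show K \ A ⊆ M.E \ A by grind [hK.1])
  rw [show (M.E \ A) \ (K \ A) = M.E \ K by grind] at hle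
  have := hK.2
  omega

lemma IsConnected.restrict_of_restrict_union (hU : IsConnected (M ↾ (C ∪ D)))
    (hI : IsConnected (M ↾ (C ∩ D))) (hne : (C ∩ D).Nonempty)
    (hrk : M.rkNat C + M.rkNat D ≤ M.rkNat (C ∩ D) + M.rkNat (C ∪ D)) :
    IsConnected (M ↾ C) := by
  have hdisj : ∀ G, IsSeparator (M ↾ C) G → (∀ e ∈ G, e ∉ D) → G = ∅ := by
    intro G hG hGD
    rw [isSeparator_restrict_iff] at hG
    have hsub := rkNat_inter_add_rkNat_union_le M (C \ G) D
    rw [show (C \ G) ∩ D = C ∩ D by grind, show C \ G ∪ D = (C ∪ D) \ G by grind] at hsub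
    have hGU : G ⊆ C ∪ D := hG.1.trans Set.subset_union_left
    have hGsep : IsSeparator (M ↾ (C ∪ D)) G :=
      isSeparator_restrict_iff.2 ⟨hGU, le_antisymm (by omega)
        (rkNat_le_rkNat_add_rkNat_sdiff M hGU)⟩
    refine (hU G hGsep).resolve_right ?_
    rintro rfl
    obtain ⟨e, -, heD⟩ := hne
    exact hGD e (Or.inr heD) heD
  intro G hG
  have hGC : G ⊆ C := hG.1
  have hsep : IsSeparator (M ↾ (C ∩ D)) (G ∩ (C ∩ D)) := by
    have := hG.inter (F := C ∩ D) Set.inter_subset_left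
    rwa [Matroid.restrict_restrict_eq _ Set.inter_subset_left] at this
  rcases hI _ hsep with h | h
  · rw [← Set.inter_assoc, Set.inter_eq_left.2 hGC, Set.eq_empty_iff_forall_notMem] at h
    exact Or.inl (hdisj G hG fun e heG heD => h e ⟨heG, heD⟩)
  · rw [Matroid.restrict_ground_eq, Set.inter_eq_right] at h
    have := hdisj _ hG.compl fun e he heD => he.2 (h ⟨he.1, heD⟩)
    exact Or.inr (hG.1.antisymm (Set.sdiff_eq_empty.1 this))

end Separator

section Flacet

/-- The sets that define the facets of the base polytope of a connected matroid, apart from the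
facets given by bounds on a single coordinate (the flacets of Feichtner and Sturmfels). -/
structure IsFlacet (M : Matroid α) (F : Set α) : Prop where
  subset_ground : F ⊆ M.E
  restrict : IsConnected (M ↾ F)
  contract : IsConnected (M ／ F)
  rkNat_lt_ncard : M.rkNat F < F.ncard
  rkNat_lt : M.rkNat F < M.rkNat M.E

variable [M.Finite]

lemma exists_isConnected_restrict_of_rkNat_lt_ncard (hBE : B ⊆ M.E) (hB : M.rkNat B < B.ncard) :
    ∃ F ⊆ M.E, IsConnected (M ↾ F) ∧ M.rkNat F < (B ∩ F).ncard := by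
  have hBfin := M.ground_finite.subset hBE
  have hfin : {F | F ⊆ M.E ∧ M.rkNat F < (B ∩ F).ncard}.Finite :=
    M.ground_finite.finite_subsets.subset fun F hF => hF.1
  obtain ⟨F, ⟨hFE, hF⟩, hmin⟩ := hfin.exists_minimal ⟨B, hBE, by rwa [Set.inter_self]⟩
  refine ⟨F, hFE, fun A hA => ?_, hF⟩
  rw [isSeparator_restrict_iff] at hA
  have hadd := ncard_inter_add_ncard_inter_sdiff hBfin hA.1
  by_cases hBA : M.rkNat A < (B ∩ A).ncard
  · exact Or.inr (hA.1.antisymm (hmin ⟨hA.1.trans hFE, hBA⟩ hA.1))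
  · have hcompl : F ⊆ F \ A := hmin
      ⟨Set.sdiff_subset.trans hFE, show M.rkNat (F \ A) < _ by omega⟩ Set.sdiff_subset
    left
    grind

lemma exists_isFlacet_rkNat_lt_ncard_inter (hM : IsConnected M) (hBE : B ⊆ M.E)
    (hBr : B.ncard = M.rkNat M.E) (hB : ¬ M.Indep B) :
    ∃ F, IsFlacet M F ∧ M.rkNat F < (B ∩ F).ncard := by
  have hBfin := M.ground_finite.subset hBE
  have hfin : {F | F ⊆ M.E ∧ IsConnected (M ↾ F) ∧ M.rkNat F < (B ∩ F).ncard}.Finite :=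
    M.ground_finite.finite_subsets.subset fun F hF => hF.1
  obtain ⟨F, ⟨hFE, hFc, hF⟩, hmax⟩ := hfin.exists_maximal
    (exists_isConnected_restrict_of_rkNat_lt_ncard hBE
      (not_le.1 fun h => hB (indep_of_ncard_le_rkNat hBfin h)))
  have hFne : F.Nonempty := by
    rw [Set.nonempty_iff_ne_empty]
    rintro rfl
    simp at hF
  refine ⟨F, ⟨hFE, hFc, fun A hA => ?_, ?_, ?_⟩, hF⟩
  · obtain ⟨hAF, hrk⟩ := (isSeparator_contract_iff hFE).1 hA
    have hinter : (A ∪ F) ∩ (M.E \ A) = F := by grind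
    have hunion : (A ∪ F) ∪ (M.E \ A) = M.E := by grind
    have hMr : IsConnected (M ↾ M.E) := by rwa [Matroid.restrict_ground_eq_self]
    have hinter' : (M.E \ A) ∩ (A ∪ F) = F := by rw [Set.inter_comm, hinter]
    have hunion' : (M.E \ A) ∪ (A ∪ F) = M.E := by rw [Set.union_comm, hunion]
    have hconn : IsConnected (M ↾ (A ∪ F)) :=
      IsConnected.restrict_of_restrict_union (D := M.E \ A) (by rwa [hunion]) (by rwa [hinter])
        (by rwa [hinter]) (by rw [hinter, hunion, hrk])
    have hconn' : IsConnected (M ↾ (M.E \ A)) :=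
      IsConnected.restrict_of_restrict_union (D := A ∪ F) (by rwa [hunion']) (by rwa [hinter'])
        (by rwa [hinter']) (by rw [hinter', hunion', add_comm, hrk])
    have hviol : M.rkNat (A ∪ F) < (B ∩ (A ∪ F)).ncard ∨
        M.rkNat (M.E \ A) < (B ∩ (M.E \ A)).ncard := by
      have hadd := Set.ncard_inter_add_ncard_union (B ∩ (A ∪ F)) (B ∩ (M.E \ A))
        (hBfin.inter_of_left _) (hBfin.inter_of_left _)
      rw [← Set.inter_inter_distrib_left, ← Set.inter_union_distrib_left, hinter, hunion,
        Set.inter_eq_left.2 hBE] at hadd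
      omega
    rcases hviol with h | h
    · have := hmax ⟨by grind, hconn, h⟩ Set.subset_union_right
      grind
    · have := hmax ⟨Set.sdiff_subset, hconn', h⟩ (by grind : F ⊆ M.E \ A)
      grind [Matroid.contract_ground]
  · exact hF.trans_le (Set.ncard_le_ncard Set.inter_subset_right (M.ground_finite.subset hFE))
  · exact hF.trans_le (hBr ▸ Set.ncard_le_ncard Set.inter_subset_left hBfin)

end Flacet

section ZeroSum

variable {i j k e f : α} {x y : α → ℝ} {W : Submodule ℝ (α → ℝ)}

/-- The difference of the unit vectors of `i` and `j`. -/
noncomputable def unitDiff (i j : α) : α → ℝ :=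
  ({i} : Set α).indicator 1 - ({j} : Set α).indicator 1

lemma unitDiff_self (i : α) : unitDiff i i = 0 := sub_self _

lemma neg_unitDiff (i j : α) : -unitDiff i j = unitDiff j i := neg_sub _ _

lemma unitDiff_add_unitDiff (i j k : α) : unitDiff i j + unitDiff j k = unitDiff i k :=
  sub_add_sub_cancel _ _ _

lemma indicator_exchange_sub (he : e ∈ B) (hf : f ∉ B) :
    (insert f (B \ {e})).indicator (1 : α → ℝ) - B.indicator 1 = unitDiff f e := by
  classical
  funext x
  simp only [unitDiff, Pi.sub_apply, Set.indicator_apply, Pi.one_apply]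
  grind

lemma indicator_union_sub_indicator_union (hI : Disjoint I B) (hJ : Disjoint J B) :
    (I ∪ B).indicator (1 : α → ℝ) - (J ∪ B).indicator 1 = I.indicator 1 - J.indicator 1 := by
  rw [Set.indicator_union_of_disjoint hI, Set.indicator_union_of_disjoint hJ]
  exact add_sub_add_right_eq_sub _ _ _

/-- The linear functional `x ↦ x(F)` for a finite set `F`. For infinite `F` it has no meaning. -/
noncomputable def coordSum (F : Set α) : (α → ℝ) →ₗ[ℝ] ℝ := ∑ᶠ e ∈ F, LinearMap.proj e

lemma coordSum_eq_sum (hF : F.Finite) (x : α → ℝ) :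
    coordSum F x = ∑ e ∈ hF.toFinset, x e := by
  simp [coordSum, finsum_mem_eq_finite_toFinset_sum _ hF]

lemma coordSum_eq_finsum_mem (hF : F.Finite) (x : α → ℝ) : coordSum F x = ∑ᶠ e ∈ F, x e := by
  rw [coordSum_eq_sum hF, finsum_mem_eq_finite_toFinset_sum _ hF]

lemma coordSum_indicator (hF : F.Finite) (B : Set α) :
    coordSum F (B.indicator 1) = (B ∩ F).ncard := by
  classical
  have h : B ∩ F = ↑(hF.toFinset.filter (· ∈ B)) := by
    ext
    simp [and_comm]
  rw [h, Set.ncard_coe_finset]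
  simp [coordSum_eq_sum hF, Set.indicator_apply, Finset.sum_boole]

lemma coordSum_unitDiff_eq_zero_iff (hF : F.Finite) :
    coordSum F (unitDiff i j) = 0 ↔ (i ∈ F ↔ j ∈ F) := by
  rw [unitDiff, map_sub, coordSum_indicator hF, coordSum_indicator hF]
  by_cases hi : i ∈ F <;> by_cases hj : j ∈ F <;> simp [hi, hj]

lemma coordSum_congr (hF : F.Finite) (h : ∀ e ∈ F, x e = y e) : coordSum F x = coordSum F y := by
  rw [coordSum_eq_sum hF, coordSum_eq_sum hF]
  exact Finset.sum_congr rfl fun e he => h e (hF.mem_toFinset.1 he)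

lemma coordSum_of_forall_eq (hF : F.Finite) {c : ℝ} (h : ∀ e ∈ F, x e = c) :
    coordSum F x = F.ncard * c := by
  rw [coordSum_congr hF h, coordSum_eq_sum hF (fun _ => c), Set.ncard_eq_toFinset_card F hF]
  simp

lemma coordSum_add_coordSum_sdiff (hY : Y.Finite) (h : X ⊆ Y) (x : α → ℝ) :
    coordSum X x + coordSum (Y \ X) x = coordSum Y x := by
  rw [coordSum_eq_finsum_mem (hY.subset h), coordSum_eq_finsum_mem hY.sdiff,
    coordSum_eq_finsum_mem hY, finsum_mem_add_sdiff h hY]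

/-- The vectors with support in `A` whose entries have sum zero. -/
noncomputable def zeroSum (A : Set α) : Submodule ℝ (α → ℝ) where
  carrier := {x | (∀ e ∉ A, x e = 0) ∧ coordSum A x = 0}
  add_mem' hx hy :=
    ⟨fun e he => by simp [hx.1 e he, hy.1 e he], by rw [map_add, hx.2, hy.2, add_zero]⟩
  zero_mem' := ⟨fun _ _ => rfl, map_zero _⟩
  smul_mem' c _ hx :=
    ⟨fun e he => by simp [hx.1 e he], by rw [map_smul, hx.2, smul_zero]⟩

lemma unitDiff_mem_zeroSum (hA : A.Finite) (hi : i ∈ A) (hj : j ∈ A) :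
    unitDiff i j ∈ zeroSum A := by
  refine ⟨fun e he => ?_, (coordSum_unitDiff_eq_zero_iff hA).2 (iff_of_true hi hj)⟩
  have hei : e ≠ i := fun h => he (h ▸ hi)
  have hej : e ≠ j := fun h => he (h ▸ hj)
  simp [unitDiff, hei, hej]

lemma zeroSum_le (hA : A.Finite) (hW : ∀ i ∈ A, ∀ j ∈ A, unitDiff i j ∈ W) : zeroSum A ≤ W := by
  rintro x ⟨hx, hsum⟩
  rcases A.eq_empty_or_nonempty with rfl | ⟨k, hk⟩
  · convert W.zero_mem
    funext e
    exact hx e (Set.notMem_empty e)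
  rw [coordSum_eq_sum hA] at hsum
  have hxsum : x = ∑ e ∈ hA.toFinset, x e • unitDiff e k := by
    classical
    simp only [unitDiff, smul_sub, Finset.sum_sub_distrib, ← Finset.sum_smul, hsum, zero_smul,
      sub_zero]
    funext e
    simp only [Finset.sum_apply, Pi.smul_apply, Set.indicator_apply, Set.mem_singleton_iff,
      Pi.one_apply, smul_eq_mul, mul_ite, mul_one, mul_zero, Finset.sum_ite_eq,
      Set.Finite.mem_toFinset]
    split_ifs with he
    · rfl
    · exact hx e he
  rw [hxsum]
  exact W.sum_mem fun e he => W.smul_mem _ (hW e (hA.mem_toFinset.1 he) k hk)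

lemma subset_or_disjoint_of_zeroSum_le_ker (hA : A.Finite) (hF : F.Finite)
    (h : zeroSum A ≤ LinearMap.ker (coordSum F)) : A ⊆ F ∨ Disjoint A F := by
  rw [or_iff_not_imp_right, Set.not_disjoint_iff]
  rintro ⟨i, hiA, hiF⟩ j hjA
  exact ((coordSum_unitDiff_eq_zero_iff hF).1 (h (unitDiff_mem_zeroSum hA hiA hjA))).1 hiF

lemma finrank_sup_span_singleton_of_notMem {𝕜 V : Type*} [Field 𝕜] [AddCommGroup V] [Module 𝕜 V]
    {p : Submodule 𝕜 V} [FiniteDimensional 𝕜 p] {v : V} (hv : v ∉ p) :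
    Module.finrank 𝕜 (p ⊔ Submodule.span 𝕜 {v} : Submodule 𝕜 V) = Module.finrank 𝕜 p + 1 := by
  have hv₀ : v ≠ 0 := fun h => hv (h ▸ p.zero_mem)
  have h := Submodule.finrank_sup_add_finrank_inf_eq p (Submodule.span 𝕜 {v})
  rwa [((Submodule.disjoint_span_singleton' hv₀).2 hv).eq_bot, finrank_bot, add_zero,
    finrank_span_singleton hv₀] at h

end ZeroSum

section BasePolytope

variable {W : Submodule ℝ (α → ℝ)} {x : α → ℝ}

lemma indicator_mem_basePolytope (hB : M.IsBase B) : B.indicator 1 ∈ M.basePolytope :=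
  subset_convexHull ℝ _ ⟨B, hB, rfl⟩

lemma vectorSpan_basePolytope (M : Matroid α) :
    vectorSpan ℝ M.basePolytope =
      vectorSpan ℝ {x | ∃ B, M.IsBase B ∧ x = B.indicator (1 : α → ℝ)} := by
  rw [Matroid.basePolytope, ← direction_affineSpan, affineSpan_convexHull, direction_affineSpan]

lemma vectorSpan_basePolytope_le (hW : ∀ B C, M.IsBase B → M.IsBase C →
    B.indicator 1 - C.indicator 1 ∈ W) : vectorSpan ℝ M.basePolytope ≤ W := by
  rw [vectorSpan_basePolytope]
  refine Submodule.span_le.2 ?_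
  rintro _ ⟨_, ⟨B, hB, rfl⟩, _, ⟨C, hC, rfl⟩, rfl⟩
  exact hW B C hB hC

lemma map_eq_of_mem_affineSpan_basePolytope (hx : x ∈ affineSpan ℝ M.basePolytope)
    {φ : (α → ℝ) →ₗ[ℝ] ℝ} {c : ℝ} (hφ : ∀ B, M.IsBase B → φ (B.indicator 1) = c) : φ x = c := by
  obtain ⟨B, hB⟩ := M.exists_isBase
  have hker : vectorSpan ℝ M.basePolytope ≤ LinearMap.ker φ :=
    vectorSpan_basePolytope_le fun B C hB hC => by simp [hφ B hB, hφ C hC]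
  have hdir := AffineSubspace.vsub_mem_direction hx
    (subset_affineSpan ℝ _ (indicator_mem_basePolytope hB))
  rw [direction_affineSpan] at hdir
  have hsub : φ (x - B.indicator 1) = 0 := hker hdir
  rwa [map_sub, hφ B hB, sub_eq_zero] at hsub

lemma indicator_mem_rankHyperplane_iff (hF : F.Finite) :
    B.indicator 1 ∈ M.rankHyperplane F ↔ IsTight M B F := by
  rw [Matroid.rankHyperplane, Set.mem_ofPred_eq, ← coordSum_eq_finsum_mem hF,
    coordSum_indicator hF, Nat.cast_inj, IsTight]

instance finiteDimensional_vectorSpan_basePolytope [M.Finite] :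
    FiniteDimensional ℝ (vectorSpan ℝ M.basePolytope) := by
  rw [vectorSpan_basePolytope]
  refine finiteDimensional_vectorSpan_of_finite ℝ ?_
  refine (M.ground_finite.finite_subsets.image fun B => B.indicator 1).subset ?_
  rintro _ ⟨B, hB, rfl⟩
  exact ⟨B, hB.subset_ground, rfl⟩

/-- The directions of the face of the base polytope in which `x(F) ≤ r(F)` is tight. -/
noncomputable def faceSpan (M : Matroid α) (F : Set α) : Submodule ℝ (α → ℝ) :=
  vectorSpan ℝ (M.basePolytope ∩ M.rankHyperplane F)

lemma faceSpan_le (M : Matroid α) (F : Set α) : faceSpan M F ≤ vectorSpan ℝ M.basePolytope :=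
  vectorSpan_mono ℝ Set.inter_subset_left

lemma faceSpan_le_ker (M : Matroid α) (hF : F.Finite) :
    faceSpan M F ≤ LinearMap.ker (coordSum F) := by
  refine Submodule.span_le.2 ?_
  rintro _ ⟨x, ⟨-, hx⟩, y, ⟨-, hy⟩, rfl⟩
  rw [Matroid.rankHyperplane, Set.mem_ofPred_eq, ← coordSum_eq_finsum_mem hF] at hx hy
  simp [hx, hy]

lemma indicator_sub_mem_faceSpan (hF : F.Finite) (hB : M.IsBase B) (hBF : IsTight M B F)
    (hC : M.IsBase C) (hCF : IsTight M C F) : B.indicator 1 - C.indicator 1 ∈ faceSpan M F :=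
  vsub_mem_vectorSpan ℝ
    ⟨indicator_mem_basePolytope hB, (indicator_mem_rankHyperplane_iff hF).2 hBF⟩
    ⟨indicator_mem_basePolytope hC, (indicator_mem_rankHyperplane_iff hF).2 hCF⟩

lemma isTight_of_forall_unitDiff_notMem [M.RankFinite] (hB : M.IsBase B) (hA : A ⊆ M.E)
    (h : ∀ f ∈ A, ∀ e ∈ M.E \ A, unitDiff f e ∉ vectorSpan ℝ M.basePolytope) :
    IsTight M B A := by
  by_contra hBA
  obtain ⟨f, hf, e, he, hbase⟩ := exists_exchange_of_not_isTight hB hA hBA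
  refine h f hf.1 e ⟨hB.subset_ground he.1, he.2⟩ ?_
  rw [← indicator_exchange_sub he.1 hf.2]
  exact vsub_mem_vectorSpan ℝ (indicator_mem_basePolytope hbase) (indicator_mem_basePolytope hB)

variable [M.Finite]

lemma IsConnected.zeroSum_le_vectorSpan (hM : IsConnected M) :
    zeroSum M.E ≤ vectorSpan ℝ M.basePolytope := by
  refine zeroSum_le M.ground_finite fun i hi j hj => ?_
  set W := vectorSpan ℝ M.basePolytope
  set A := {e ∈ M.E | unitDiff e j ∈ W}
  have hA : A ⊆ M.E := Set.sep_subset _ _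
  have hsep : ∀ f ∈ A, ∀ e ∈ M.E \ A, unitDiff f e ∉ W := by
    intro f hf e he hfe
    refine he.2 ⟨he.1, ?_⟩
    rw [← unitDiff_add_unitDiff e f j, ← neg_unitDiff f e]
    exact W.add_mem (W.neg_mem hfe) hf.2
  have hsep' : ∀ f ∈ M.E \ A, ∀ e ∈ M.E \ (M.E \ A), unitDiff f e ∉ W := by
    intro f hf e he hfe
    rw [Set.sdiff_sdiff_cancel_left hA] at he
    exact hsep e he f hf (neg_unitDiff f e ▸ W.neg_mem hfe)
  obtain ⟨B, hB⟩ := M.exists_isBase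
  have hjA : j ∈ A := ⟨hj, unitDiff_self j ▸ W.zero_mem⟩
  have hAE : A = M.E := (hM A (isSeparator_of_isTight hA hB
    (isTight_of_forall_unitDiff_notMem hB hA hsep)
    (isTight_of_forall_unitDiff_notMem hB Set.sdiff_subset hsep'))).resolve_left
      (Set.nonempty_of_mem hjA).ne_empty
  exact (hAE ▸ hi : i ∈ A).2

lemma IsConnected.zeroSum_le (hM : IsConnected M) (hB : Disjoint M.E B)
    (hW : ∀ I J, M.IsBase I → M.IsBase J → (I ∪ B).indicator 1 - (J ∪ B).indicator 1 ∈ W) :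
    zeroSum M.E ≤ W :=
  hM.zeroSum_le_vectorSpan.trans <| vectorSpan_basePolytope_le fun I J hI hJ =>
    indicator_union_sub_indicator_union (hB.mono_left hI.subset_ground)
      (hB.mono_left hJ.subset_ground) ▸ hW I J hI hJ

end BasePolytope

section Facet

variable {G L : Set α} {W : Submodule ℝ (α → ℝ)}

lemma IsFlacet.nonempty (hF : IsFlacet M F) : F.Nonempty := by
  rw [Set.nonempty_iff_ne_empty]
  rintro rfl
  simpa using hF.rkNat_lt_ncard

lemma IsFlacet.sdiff_nonempty (hF : IsFlacet M F) : (M.E \ F).Nonempty := by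
  rw [Set.nonempty_iff_ne_empty, Ne, Set.sdiff_eq_empty]
  intro h
  have := hF.rkNat_lt
  rw [hF.subset_ground.antisymm h] at this
  exact lt_irrefl _ this

lemma isBase_union_and_isTight [M.RankFinite] (hK : IsSeparator M K) (hFK : F ⊆ K)
    (hI : (M ↾ F).IsBase I) (hJ : ((M ↾ K) ／ F).IsBase J) (hL : (M ↾ (M.E \ K)).IsBase L) :
    M.IsBase (I ∪ J ∪ L) ∧ IsTight M (I ∪ J ∪ L) F := by
  have hIF : I ⊆ F := hI.subset_ground
  have hJK : J ⊆ K \ F := hJ.subset_ground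
  have hLK : L ⊆ M.E \ K := hL.subset_ground
  constructor
  · refine hK.isBase_union (isBase_union_of_isBase_restrict_of_isBase_contract ?_ hJ hFK) hL
    rwa [Matroid.restrict_restrict_eq _ hFK]
  · rw [IsTight, show (I ∪ J ∪ L) ∩ F = I by grind]
    exact ncard_eq_rkNat_of_isBasis ((Matroid.isBase_restrict_iff (hFK.trans hK.1)).1 hI)

variable [M.Finite]

lemma IsFlacet.zeroSum_le (hK : IsSeparator M K) (hF : IsFlacet (M ↾ K) F)
    (hW : ∀ B C, M.IsBase B → IsTight M B F → M.IsBase C → IsTight M C F →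
      B.indicator 1 - C.indicator 1 ∈ W) :
    zeroSum F ≤ W ∧ zeroSum (K \ F) ≤ W := by
  have hKfin : K.Finite := M.ground_finite.subset hK.1
  have hFK : F ⊆ K := hF.subset_ground
  have : (M ↾ F).Finite := Matroid.restrict_finite (hKfin.subset hFK)
  have : (M ↾ K).Finite := Matroid.restrict_finite hKfin
  obtain ⟨L, hL⟩ := (M ↾ (M.E \ K)).exists_isBase
  have hLK : L ⊆ M.E \ K := hL.subset_ground
  constructor
  · have hFc := hF.restrict
    rw [Matroid.restrict_restrict_eq _ hFK] at hFc
    obtain ⟨J, hJ⟩ := ((M ↾ K) ／ F).exists_isBase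
    have hJK : J ⊆ K \ F := hJ.subset_ground
    refine hFc.zeroSum_le (B := J ∪ L) ?_ fun I I' hI hI' => ?_
    · rw [Matroid.restrict_ground_eq]
      grind
    · rw [← Set.union_assoc, ← Set.union_assoc]
      have h := isBase_union_and_isTight hK hFK hI hJ hL
      have h' := isBase_union_and_isTight hK hFK hI' hJ hL
      exact hW _ _ h.1 h.2 h'.1 h'.2
  · obtain ⟨I, hI⟩ := (M ↾ F).exists_isBase
    have hIF : I ⊆ F := hI.subset_ground
    refine hF.contract.zeroSum_le (B := I ∪ L) ?_ fun J J' hJ hJ' => ?_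
    · rw [Matroid.contract_ground, Matroid.restrict_ground_eq]
      grind
    · rw [← Set.union_assoc, Set.union_comm J I, ← Set.union_assoc, Set.union_comm J' I]
      have h := isBase_union_and_isTight hK hFK hI hJ hL
      have h' := isBase_union_and_isTight hK hFK hI hJ' hL
      exact hW _ _ h.1 h.2 h'.1 h'.2

lemma zeroSum_le_vectorSpan_basePolytope (hK : IsSeparator M K) (hKc : IsConnected (M ↾ K)) :
    zeroSum K ≤ vectorSpan ℝ M.basePolytope := by
  have : (M ↾ K).Finite := Matroid.restrict_finite (M.ground_finite.subset hK.1)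
  obtain ⟨L, hL⟩ := (M ↾ (M.E \ K)).exists_isBase
  have hLK : L ⊆ M.E \ K := hL.subset_ground
  refine hKc.zeroSum_le (B := L) (Set.disjoint_sdiff_right.mono_right hLK) fun I J hI hJ => ?_
  exact vsub_mem_vectorSpan ℝ (indicator_mem_basePolytope (hK.isBase_union hI hL))
    (indicator_mem_basePolytope (hK.isBase_union hJ hL))

lemma IsSeparator.indicator_sub_mem_zeroSum (hK : IsSeparator M K) (hB : M.IsBase B)
    (hC : M.IsBase C) (h : ∀ e ∉ K, (e ∈ B ↔ e ∈ C)) :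
    B.indicator 1 - C.indicator 1 ∈ zeroSum K := by
  refine ⟨fun e he => ?_, ?_⟩
  · by_cases heB : e ∈ B
    · simp [heB, (h e he).1 heB]
    · simp [heB, mt (h e he).2 heB]
  · have hKfin := M.ground_finite.subset hK.1
    rw [map_sub, coordSum_indicator hKfin, coordSum_indicator hKfin, hK.isTight hB, hK.isTight hC,
      sub_self]

lemma IsSeparator.vectorSpan_basePolytope_le (hK : IsSeparator M K) (hFK : F ⊆ K) :
    vectorSpan ℝ M.basePolytope ≤ faceSpan M F ⊔ zeroSum K := by
  obtain ⟨T, hT, hTF, -⟩ := exists_isBase_isTight_isTight hFK hK.1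
  have hmix : ∀ B, M.IsBase B → ∃ B', M.IsBase B' ∧ IsTight M B' F ∧
      B.indicator 1 - B'.indicator 1 ∈ zeroSum K := by
    intro B hB
    have hB' := hK.isBase_union (hK.isBase_inter hT) (hK.compl.isBase_inter hB)
    refine ⟨_, hB', ?_, hK.indicator_sub_mem_zeroSum hB hB' (by grind [hB.subset_ground])⟩
    rw [IsTight, ← hTF]
    congr 1
    grind
  refine SplitMatroid.vectorSpan_basePolytope_le fun B C hB hC => ?_
  obtain ⟨B', hB', hB'F, hBB'⟩ := hmix B hB
  obtain ⟨C', hC', hC'F, hCC'⟩ := hmix C hC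
  have hFfin := M.ground_finite.subset (hFK.trans hK.1)
  have h := Submodule.add_mem_sup (indicator_sub_mem_faceSpan hFfin hB' hB'F hC' hC'F)
    (Submodule.sub_mem _ hBB' hCC')
  convert h using 1
  abel

lemma IsFlacet.isFacetDefining (hK : IsSeparator M K) (hKc : IsConnected (M ↾ K))
    (hF : IsFlacet (M ↾ K) F) : M.IsFacetDefining F := by
  have hFK : F ⊆ K := hF.subset_ground
  have hKfin := M.ground_finite.subset hK.1
  have hFfin := hKfin.subset hFK
  obtain ⟨T, hT, hTF, -⟩ := exists_isBase_isTight_isTight hFK hK.1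
  refine ⟨hFK.trans hK.1,
    ⟨_, indicator_mem_basePolytope hT, (indicator_mem_rankHyperplane_iff hFfin).2 hTF⟩, ?_⟩
  change Module.finrank ℝ (faceSpan M F) + 1 = _
  have hfin : FiniteDimensional ℝ (faceSpan M F) :=
    Submodule.finiteDimensional_of_le (faceSpan_le M F)
  obtain ⟨i, hi⟩ := hF.nonempty
  obtain ⟨j, hjK, hjF⟩ := hF.sdiff_nonempty
  have hij : unitDiff i j ∉ faceSpan M F := fun h =>
    hjF (((coordSum_unitDiff_eq_zero_iff hFfin).1 (faceSpan_le_ker M hFfin h)).1 hi)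
  obtain ⟨hin, hout⟩ := hF.zeroSum_le hK fun B C hB hBF hC hCF =>
    indicator_sub_mem_faceSpan hFfin hB hBF hC hCF
  set U := faceSpan M F ⊔ Submodule.span ℝ {unitDiff i j} with hU
  have hijU : unitDiff i j ∈ U := Submodule.mem_sup_right (Submodule.mem_span_singleton_self _)
  have hunit : ∀ a ∈ K, unitDiff a j ∈ U := by
    intro a ha
    by_cases haF : a ∈ F
    · rw [← unitDiff_add_unitDiff a i j]
      exact U.add_mem (Submodule.mem_sup_left (hin (unitDiff_mem_zeroSum hFfin haF hi))) hijU
    · exact Submodule.mem_sup_left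
        (hout (unitDiff_mem_zeroSum hKfin.sdiff ⟨ha, haF⟩ ⟨hjK, hjF⟩))
  have hKU : zeroSum K ≤ U := SplitMatroid.zeroSum_le hKfin fun a ha b hb => by
    rw [← unitDiff_add_unitDiff a j b, ← neg_unitDiff b j]
    exact U.add_mem (hunit a ha) (U.neg_mem (hunit b hb))
  have hUV : U = vectorSpan ℝ M.basePolytope := by
    refine le_antisymm (sup_le (faceSpan_le M F) ?_)
      ((hK.vectorSpan_basePolytope_le hFK).trans (sup_le le_sup_left hKU))
    rw [Submodule.span_singleton_le_iff_mem]
    exact zeroSum_le_vectorSpan_basePolytope hK hKc (unitDiff_mem_zeroSum hKfin (hFK hi) hjK)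
  rw [← hUV, hU, finrank_sup_span_singleton_of_notMem hij]

lemma IsFlacet.rkNat_lt_rkNat_add_rkNat_sdiff (hM : IsConnected M) (hF : IsFlacet M F) :
    M.rkNat M.E < M.rkNat F + M.rkNat (M.E \ F) := by
  by_contra! h
  rcases hM F (isSeparator_of_le hF.subset_ground h) with h | h
  · exact hF.nonempty.ne_empty h
  · exact hF.sdiff_nonempty.ne_empty (Set.sdiff_eq_empty.2 h.ge)

lemma IsFlacet.exists_isTight_not_isTight (hK : IsSeparator M K) (hKc : IsConnected (M ↾ K))
    (hF : IsFlacet (M ↾ K) F) (hG : IsFlacet (M ↾ K) G) (hne : F ≠ G) :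
    ∃ B, M.IsBase B ∧ IsTight M B F ∧ ¬ IsTight M B G := by
  by_contra! htight
  have hFK : F ⊆ K := hF.subset_ground
  have hGK : G ⊆ K := hG.subset_ground
  have hKfin := M.ground_finite.subset hK.1
  have hGfin := hKfin.subset hGK
  obtain ⟨hin, hout⟩ := hF.zeroSum_le (W := LinearMap.ker (coordSum G)) hK
    fun B C hB hBF hC hCF => by
      rw [LinearMap.mem_ker, map_sub, coordSum_indicator hGfin, coordSum_indicator hGfin,
        htight B hB hBF, htight C hC hCF, sub_self]
  obtain ⟨x, hxK, hxG⟩ := hG.sdiff_nonempty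
  obtain ⟨y, hyG⟩ := hG.nonempty
  rw [Matroid.restrict_ground_eq] at hxK
  rcases subset_or_disjoint_of_zeroSum_le_ker (hKfin.subset hFK) hGfin hin with hFG | hFG <;>
    rcases subset_or_disjoint_of_zeroSum_le_ker hKfin.sdiff hGfin hout with hFG' | hFG'
  · grind
  · grind
  · have hGeq : G = K \ F := by grind
    obtain ⟨T, hT, hTF, hTK⟩ := exists_isBase_isTight_isTight hFK hK.1
    have hTG := htight T hT hTF
    have hadd := ncard_inter_add_ncard_inter_sdiff hT.finite hFK
    rw [← hGeq, hTF, hTG, hTK, hGeq] at hadd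
    have : (M ↾ K).Finite := Matroid.restrict_finite hKfin
    have hlt := hF.rkNat_lt_rkNat_add_rkNat_sdiff hKc
    rw [rkNat_restrict_ground, rkNat_restrict M hFK, Matroid.restrict_ground_eq,
      rkNat_restrict M Set.sdiff_subset] at hlt
    omega
  · grind

lemma IsFlacet.rkNat_lt_rkNat_add_ncard_sdiff (hK : IsSeparator M K) (hKc : IsConnected (M ↾ K))
    (hF : IsFlacet (M ↾ K) F) (hG : IsFlacet (M ↾ K) G) (hne : F ≠ G) :
    M.rkNat F < M.rkNat G + (F \ G).ncard := by
  obtain ⟨B, hB, hBF, hBG⟩ := hF.exists_isTight_not_isTight hK hKc hG hne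
  have hFfin : F.Finite := M.ground_finite.subset (hF.subset_ground.trans hK.1)
  calc M.rkNat F = (B ∩ F).ncard := hBF.symm
    _ ≤ (B ∩ G ∪ F \ G).ncard :=
      Set.ncard_le_ncard (by grind) ((hB.finite.inter_of_left G).union hFfin.sdiff)
    _ ≤ (B ∩ G).ncard + (F \ G).ncard := Set.ncard_union_le _ _
    _ < M.rkNat G + (F \ G).ncard :=
      Nat.add_lt_add_right ((ncard_inter_le_rkNat hB.indep G).lt_of_ne hBG) _

lemma rkNat_le_ncard (M : Matroid α) (hX : X.Finite) : M.rkNat X ≤ X.ncard :=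
  ENat.toNat_le_toNat (M.eRk_le_encard X) hX.encard_lt_top.ne

lemma IsFlacet.rkNat_lt_rkNat_add_rkNat_add_ncard (hM : IsConnected M) (hF : IsFlacet M F)
    (G : Set α) : M.rkNat M.E < M.rkNat F + M.rkNat G + (M.E \ (F ∪ G)).ncard := by
  have hlt := hF.rkNat_lt_rkNat_add_rkNat_sdiff hM
  have hle := rkNat_le_rkNat_add_rkNat_sdiff M (X := G ∩ (M.E \ F)) Set.inter_subset_right
  have hGle := rkNat_mono (M := M) (Set.inter_subset_left (s := G) (t := M.E \ F))
  rw [show (M.E \ F) \ (G ∩ (M.E \ F)) = M.E \ (F ∪ G) by grind] at hle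
  have hcard := rkNat_le_ncard M (X := M.E \ (F ∪ G)) M.ground_finite.sdiff
  omega

end Facet

section AtomDensity

variable {F G K : Set α} {p q r : ℕ}

lemma exists_forall_mem_openSegment {ι : Type*} [Finite ι] [Nonempty ι] {l u : ι → ℝ}
    (hle : ∀ i, l i ≤ u i) (hlt : ∀ i j, i ≠ j → l i < u j) :
    ∃ z, ∀ i, z ∈ openSegment ℝ (l i) (u i) := by
  by_cases h : ∃ i, l i = u i
  · obtain ⟨i, hi⟩ := h
    refine ⟨u i, fun j => ?_⟩
    rcases eq_or_ne j i with rfl | hji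
    · rw [hi, openSegment_same]
      rfl
    · rw [openSegment_eq_Ioo ((hlt j i hji).trans (hi ▸ hlt i j hji.symm))]
      exact ⟨hlt j i hji, hi ▸ hlt i j hji.symm⟩
  · push Not at h
    have hlt' : ∀ i j, l i < u j := fun i j => by
      rcases eq_or_ne i j with rfl | hij
      · exact (hle i).lt_of_ne (h i)
      · exact hlt i j hij
    obtain ⟨i, hi⟩ := Finite.exists_max l
    obtain ⟨j, hj⟩ := Finite.exists_min u
    obtain ⟨z, hz, hz'⟩ := exists_between (hlt' i j)
    refine ⟨z, fun k => ?_⟩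
    rw [openSegment_eq_Ioo (hlt' k k)]
    exact ⟨(hi k).trans_lt hz, hz'.trans_le (hj k)⟩

lemma exists_density_of_mem_openSegment {a n z : ℝ} (h : z ∈ openSegment ℝ a (a + n)) :
    ∃ t, 0 < t ∧ t < 1 ∧ n * t = z - a := by
  obtain ⟨s, t, hs, ht, hst, rfl⟩ := h
  refine ⟨t, ht, by linarith, ?_⟩
  rw [smul_eq_mul, smul_eq_mul, eq_sub_of_add_eq hst]
  ring

lemma exists_coordSum_eq_of_density (hK : K.Finite) (hFK : F ⊆ K) (hGK : G ⊆ K)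
    {t₁ t₂ t₃ t₄ : ℝ} (h₁ : 0 < t₁ ∧ t₁ < 1) (h₂ : 0 < t₂ ∧ t₂ < 1) (h₃ : 0 < t₃ ∧ t₃ < 1)
    (h₄ : 0 < t₄ ∧ t₄ < 1) :
    ∃ x : α → ℝ, (∀ e, 0 < x e ∧ x e < 1) ∧
      coordSum F x = (F ∩ G).ncard * t₁ + (F \ G).ncard * t₂ ∧
      coordSum G x = (F ∩ G).ncard * t₁ + (G \ F).ncard * t₃ ∧
      coordSum K x = coordSum F x + (G \ F).ncard * t₃ + (K \ (F ∪ G)).ncard * t₄ := by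
  classical
  have hF := hK.subset hFK
  have hG := hK.subset hGK
  set x : α → ℝ := fun e =>
    if e ∈ F then if e ∈ G then t₁ else t₂ else if e ∈ G then t₃ else t₄
  have hsum₁ : coordSum (F ∩ G) x = (F ∩ G).ncard * t₁ :=
    coordSum_of_forall_eq (hF.inter_of_left G) fun e he => by grind
  have hsum₂ : coordSum (F \ G) x = (F \ G).ncard * t₂ :=
    coordSum_of_forall_eq hF.sdiff fun e he => by grind
  have hsum₃ : coordSum (G \ F) x = (G \ F).ncard * t₃ :=
    coordSum_of_forall_eq hG.sdiff fun e he => by grind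
  have hsum₄ : coordSum (K \ (F ∪ G)) x = (K \ (F ∪ G)).ncard * t₄ :=
    coordSum_of_forall_eq hK.sdiff fun e he => by grind
  refine ⟨x, fun e => by grind, ?_, ?_, ?_⟩
  · rw [← coordSum_add_coordSum_sdiff hF (Set.inter_subset_left (t := G)), Set.sdiff_self_inter,
      hsum₁, hsum₂]
  · rw [← coordSum_add_coordSum_sdiff hG (Set.inter_subset_right (s := F)),
      Set.sdiff_inter_self_eq_sdiff, hsum₁, hsum₃]
  · rw [← coordSum_add_coordSum_sdiff hK hFK,
      ← coordSum_add_coordSum_sdiff hK.sdiff (X := G \ F) (by grind),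
      show (K \ F) \ (G \ F) = K \ (F ∪ G) by grind, hsum₃, hsum₄, add_assoc]

lemma exists_coordSum_eq (hK : K.Finite) (hFK : F ⊆ K) (hGK : G ⊆ K)
    (hp : 0 < p) (hq : 0 < q) (hpF : p < F.ncard) (hqG : q < G.ncard) (hpr : p < r) (hqr : q < r)
    (hrF : r < p + (K \ F).ncard) (hrG : r < q + (K \ G).ncard)
    (hpq : p < q + (F \ G).ncard) (hqp : q < p + (G \ F).ncard)
    (hinter : p + q < (F ∩ G).ncard + r) (hunion : r < p + q + (K \ (F ∪ G)).ncard) :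
    ∃ x : α → ℝ, (∀ e, 0 < x e ∧ x e < 1) ∧
      coordSum F x = p ∧ coordSum G x = q ∧ coordSum K x = r := by
  have hFfin := hK.subset hFK
  have hGfin := hK.subset hGK
  have hF := Set.ncard_inter_add_ncard_sdiff_eq_ncard F G hFfin
  have hG := Set.ncard_inter_add_ncard_sdiff_eq_ncard G F hGfin
  have hKF := Set.ncard_inter_add_ncard_sdiff_eq_ncard (K \ F) G hK.sdiff
  have hKG := Set.ncard_inter_add_ncard_sdiff_eq_ncard (K \ G) F hK.sdiff
  rw [Set.inter_comm] at hG
  rw [show K \ F ∩ G = G \ F by grind, show (K \ F) \ G = K \ (F ∪ G) by grind] at hKF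
  rw [show K \ G ∩ F = F \ G by grind, show (K \ G) \ F = K \ (F ∪ G) by grind] at hKG
  set n₁ := (F ∩ G).ncard
  set n₂ := (F \ G).ncard
  set n₃ := (G \ F).ncard
  set n₄ := (K \ (F ∪ G)).ncard
  rify at *
  -- A function constant on the four atoms is determined by its sum `z` over `F ∩ G`, and its
  -- values lie in `(0, 1)` if and only if `z` lies in four open segments, which are points for
  -- the empty atoms.
  obtain ⟨z, hz⟩ := exists_forall_mem_openSegment
    (l := ![0, p - n₂, q - n₃, p + q - r])
    (u := ![0 + n₁, p - n₂ + n₂, q - n₃ + n₃, p + q - r + n₄])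
    (fun i => by fin_cases i <;> simp)
    (fun i j hij => by
      fin_cases i <;> fin_cases j <;> first
      | exact absurd rfl hij
      | simp only [Fin.reduceFinMk, Fin.zero_eta, Fin.mk_one, Matrix.cons_val]; linarith)
  obtain ⟨t₁, h₁, h₁', ht₁⟩ := exists_density_of_mem_openSegment (hz 0)
  obtain ⟨t₂, h₂, h₂', ht₂⟩ := exists_density_of_mem_openSegment (hz 1)
  obtain ⟨t₃, h₃, h₃', ht₃⟩ := exists_density_of_mem_openSegment (hz 2)
  obtain ⟨t₄, h₄, h₄', ht₄⟩ := exists_density_of_mem_openSegment (hz 3)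
  simp only [Matrix.cons_val] at ht₁ ht₂ ht₃ ht₄
  obtain ⟨x, hx, hxF, hxG, hxK⟩ := exists_coordSum_eq_of_density hK hFK hGK ⟨h₁, h₁'⟩
    (t₂ := 1 - t₂) ⟨by linarith, by linarith⟩ (t₃ := 1 - t₃) ⟨by linarith, by linarith⟩ ⟨h₄, h₄'⟩
  have hxF' : coordSum F x = p := by linarith
  have hxG' : coordSum G x = q := by linarith
  exact ⟨x, hx, hxF', hxG', by linarith⟩

end AtomDensity

section Compatibility

variable {G : Set α} {x : α → ℝ}

/-- A base whose complement is a base as well. -/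
structure IsBisectingBase (M : Matroid α) (B : Set α) : Prop where
  isBase : M.IsBase B
  isBase_compl : M.IsBase (M.E \ B)

lemma IsBisectingBase.compl (hB : IsBisectingBase M B) : IsBisectingBase M (M.E \ B) :=
  ⟨hB.isBase_compl, by rw [Set.sdiff_sdiff_cancel_left hB.isBase.subset_ground]; exact hB.isBase⟩

lemma IsBisectingBase.indicator_half_mem_basePolytope (hB : IsBisectingBase M B) :
    M.E.indicator (fun _ => 1 / 2) ∈ M.basePolytope := by
  classical
  have h := convex_convexHull ℝ _ (indicator_mem_basePolytope hB.isBase)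
    (indicator_mem_basePolytope hB.isBase_compl) (by norm_num : (0 : ℝ) ≤ 1 / 2)
    (by norm_num : (0 : ℝ) ≤ 1 / 2) (by norm_num)
  convert! h using 1
  funext e
  have hBE : e ∈ B → e ∈ M.E := fun he => hB.isBase.subset_ground he
  by_cases heB : e ∈ B <;> by_cases heE : e ∈ M.E <;> simp_all

variable [M.Finite]

lemma IsBisectingBase.ncard_inter_add_ncard_inter (hB : IsBisectingBase M B) (hA : A ⊆ M.E) :
    (B ∩ A).ncard + ((M.E \ B) ∩ A).ncard = A.ncard := by
  have h := ncard_inter_add_ncard_inter_sdiff (M.ground_finite.subset hA) hB.isBase.subset_ground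
  rwa [Set.inter_eq_left.2 hA, Set.inter_comm A, Set.inter_comm A] at h

lemma IsBisectingBase.ncard_le (hB : IsBisectingBase M B) (hA : A ⊆ M.E) :
    A.ncard ≤ 2 * M.rkNat A := by
  have hle := ncard_inter_le_rkNat hB.isBase.indep A
  have hle' := ncard_inter_le_rkNat hB.isBase_compl.indep A
  have hadd := hB.ncard_inter_add_ncard_inter hA
  omega

lemma IsBisectingBase.ncard_eq (hB : IsBisectingBase M B) (hK : IsSeparator M K) :
    K.ncard = 2 * M.rkNat K := by
  rw [← hB.ncard_inter_add_ncard_inter hK.1, hK.isTight hB.isBase, hK.isTight hB.isBase_compl,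
    two_mul]

lemma mem_ambientPolytope (hx : x ∈ affineSpan ℝ M.basePolytope)
    (h : ∀ e ∈ M.E, x e ∈ Set.Ioo 0 1) : x ∈ M.ambientPolytope := by
  refine ⟨hx, fun e he => ⟨(h e he).1.le, (h e he).2.le⟩, fun e he => ?_, ?_⟩
  · exact map_eq_of_mem_affineSpan_basePolytope hx (φ := LinearMap.proj e) fun B hB =>
      Set.indicator_of_notMem (fun heB => he (hB.subset_ground heB)) _
  · rw [← coordSum_eq_finsum_mem M.ground_finite]
    refine map_eq_of_mem_affineSpan_basePolytope hx fun B hB => ?_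
    rw [coordSum_indicator M.ground_finite, Set.inter_eq_left.2 hB.subset_ground,
      ncard_eq_rkNat_of_isBase hB]

lemma mem_intrinsicInterior_ambientPolytope (hx : x ∈ affineSpan ℝ M.basePolytope)
    (h : ∀ e ∈ M.E, x e ∈ Set.Ioo 0 1) : x ∈ intrinsicInterior ℝ M.ambientPolytope := by
  have hxQ := mem_ambientPolytope hx h
  have hle : affineSpan ℝ M.ambientPolytope ≤ affineSpan ℝ M.basePolytope :=
    affineSpan_le.2 Set.inter_subset_left
  refine mem_intrinsicInterior.2 ⟨⟨x, subset_affineSpan ℝ _ hxQ⟩, mem_interior.2 ?_, rfl⟩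
  refine ⟨Subtype.val ⁻¹' M.E.pi fun _ => Set.Ioo (0 : ℝ) 1, fun y hy => ?_, ?_, h⟩
  · exact mem_ambientPolytope (hle y.2) hy
  · exact (isOpen_set_pi M.ground_finite fun _ _ => isOpen_Ioo).preimage continuous_subtype_val

lemma IsBisectingBase.mem_affineSpan_basePolytope (hB : IsBisectingBase M B)
    (hK : IsSeparator M K) (hKc : IsConnected (M ↾ K))
    (hx : ∀ e ∉ K, x e = M.E.indicator (fun _ => 1 / 2) e) (hsum : coordSum K x = M.rkNat K) :
    x ∈ affineSpan ℝ M.basePolytope := by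
  have hKfin := M.ground_finite.subset hK.1
  set c : α → ℝ := M.E.indicator fun _ => 1 / 2
  have hsub : x - c ∈ zeroSum K := by
    refine ⟨fun e he => by simp [hx e he], ?_⟩
    have hc : ∀ e ∈ K, c e = 1 / 2 := fun e he => Set.indicator_of_mem (hK.1 he) _
    rw [map_sub, hsum, coordSum_of_forall_eq hKfin hc, hB.ncard_eq hK]
    push_cast
    ring
  have hdir := zeroSum_le_vectorSpan_basePolytope hK hKc hsub
  rw [← direction_affineSpan] at hdir
  rw [← sub_add_cancel x c]
  exact AffineSubspace.vadd_mem_of_mem_direction hdir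
    (subset_affineSpan ℝ _ hB.indicator_half_mem_basePolytope)

lemma IsBisectingBase.exists_coordSum_eq_rkNat (hB : IsBisectingBase M B) (hK : IsSeparator M K)
    (hKc : IsConnected (M ↾ K)) (hF : IsFlacet (M ↾ K) F) (hG : IsFlacet (M ↾ K) G) (hne : F ≠ G)
    (hlt : M.rkNat F + M.rkNat G < (F ∩ G).ncard + M.rkNat K) :
    ∃ x : α → ℝ, (∀ e, 0 < x e ∧ x e < 1) ∧ coordSum F x = M.rkNat F ∧
      coordSum G x = M.rkNat G ∧ coordSum K x = M.rkNat K := by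
  have hFK : F ⊆ K := hF.subset_ground
  have hGK : G ⊆ K := hG.subset_ground
  have hKfin := M.ground_finite.subset hK.1
  have hFG := hF.rkNat_lt_rkNat_add_ncard_sdiff hK hKc hG hne
  have hGF := hG.rkNat_lt_rkNat_add_ncard_sdiff hK hKc hF hne.symm
  have : (M ↾ K).Finite := Matroid.restrict_finite hKfin
  have hunion := hF.rkNat_lt_rkNat_add_rkNat_add_ncard hKc G
  have hF₁ := hF.rkNat_lt_ncard
  have hG₁ := hG.rkNat_lt_ncard
  have hF₂ := hF.rkNat_lt
  have hG₂ := hG.rkNat_lt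
  rw [rkNat_restrict_ground, rkNat_restrict M hFK] at hF₂
  rw [rkNat_restrict_ground, rkNat_restrict M hGK] at hG₂
  rw [rkNat_restrict_ground, rkNat_restrict M hFK, rkNat_restrict M hGK] at hunion
  rw [rkNat_restrict M hFK] at hF₁
  rw [rkNat_restrict M hGK] at hG₁
  have hF₃ := hB.ncard_le (hFK.trans hK.1)
  have hG₃ := hB.ncard_le (hGK.trans hK.1)
  have hK₃ := hB.ncard_eq hK
  have hF₄ := Set.ncard_sdiff_add_ncard_of_subset hFK hKfin
  have hG₄ := Set.ncard_sdiff_add_ncard_of_subset hGK hKfin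
  exact exists_coordSum_eq hKfin hFK hGK (by omega) (by omega) hF₁ hG₁ hF₂ hG₂ (by omega)
    (by omega) hFG hGF hlt hunion

lemma IsBisectingBase.rankHyperplane_inter_nonempty (hB : IsBisectingBase M B)
    (hK : IsSeparator M K) (hKc : IsConnected (M ↾ K)) (hF : IsFlacet (M ↾ K) F)
    (hG : IsFlacet (M ↾ K) G) (hne : F ≠ G)
    (hlt : M.rkNat F + M.rkNat G < (F ∩ G).ncard + M.rkNat K) :
    (M.rankHyperplane F ∩ M.rankHyperplane G ∩
      intrinsicInterior ℝ M.ambientPolytope).Nonempty := by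
  classical
  have hKfin := M.ground_finite.subset hK.1
  obtain ⟨x, hx, hxF, hxG, hxK⟩ := hB.exists_coordSum_eq_rkNat hK hKc hF hG hne hlt
  set y : α → ℝ := K.piecewise x (M.E.indicator fun _ => 1 / 2) with hy
  have hyK : ∀ {A}, A ⊆ K → coordSum A y = coordSum A x := fun hA =>
    coordSum_congr (hKfin.subset hA) fun e he => Set.piecewise_eq_of_mem _ _ _ (hA he)
  have hspan : y ∈ affineSpan ℝ M.basePolytope := hB.mem_affineSpan_basePolytope hK hKc
    (fun e he => Set.piecewise_eq_of_notMem _ _ _ he) ((hyK subset_rfl).trans hxK)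
  refine ⟨y, ⟨?_, ?_⟩, mem_intrinsicInterior_ambientPolytope hspan fun e he => ?_⟩
  · exact (coordSum_eq_finsum_mem (hKfin.subset hF.subset_ground) y).symm.trans
      ((hyK hF.subset_ground).trans hxF)
  · exact (coordSum_eq_finsum_mem (hKfin.subset hG.subset_ground) y).symm.trans
      ((hyK hG.subset_ground).trans hxG)
  · by_cases heK : e ∈ K
    · simpa [hy, heK] using hx e
    · simp only [hy, heK, he, Set.piecewise_eq_of_notMem, not_false_eq_true, Set.indicator_of_mem]
      norm_num

lemma ncard_inter_add_rkNat_le (hM : M.IsSplit) (hB : IsBisectingBase M B)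
    (hK : IsSeparator M K) (hKc : IsConnected (M ↾ K)) (hF : IsFlacet (M ↾ K) F)
    (hG : IsFlacet (M ↾ K) G) (hne : F ≠ G) :
    (F ∩ G).ncard + M.rkNat K ≤ M.rkNat F + M.rkNat G := by
  by_contra! hlt
  obtain ⟨x, ⟨hxF, hxG⟩, hx⟩ := hB.rankHyperplane_inter_nonempty hK hKc hF hG hne hlt
  refine Set.notMem_empty x <| hM F G ⟨hF.isFacetDefining hK hKc, x, hxF, hx⟩
    ⟨hG.isFacetDefining hK hKc, x, hxG, hx⟩ (fun h => ?_) ▸ ⟨⟨hxF, hxG⟩, hx⟩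
  obtain ⟨T, hT, hTF, hTG⟩ := hF.exists_isTight_not_isTight hK hKc hG hne
  have hfin : ∀ {A}, A ⊆ K → A.Finite := fun hA => M.ground_finite.subset (hA.trans hK.1)
  have hmem : T.indicator 1 ∈ M.basePolytope ∩ M.rankHyperplane G := h ▸
    ⟨indicator_mem_basePolytope hT,
      (indicator_mem_rankHyperplane_iff (hfin hF.subset_ground)).2 hTF⟩
  exact hTG ((indicator_mem_rankHyperplane_iff (hfin hG.subset_ground)).1 hmem.2)

end Compatibility

section Equitable

variable [M.Finite]

/-- The elements of `K` where `v` is `1`. -/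
def positivePart (K : Set α) (v : α → ℤ) : Set α := {e ∈ K | v e = 1}

lemma IsSign.sdiff_positivePart {v : α → ℤ} (hv : IsSign v) (K : Set α) :
    K \ positivePart K v = positivePart K (-v) := by
  ext e
  rcases hv e with h | h <;> simp [positivePart, h]

lemma IsSign.ncard_positivePart_inter {v : α → ℤ} (hv : IsSign v) {A : Finset α}
    (hA : (A : Set α) ⊆ K) :
    2 * ((positivePart K v ∩ A).ncard : ℤ) = A.card + ∑ e ∈ A, v e := by
  classical
  have hset : positivePart K v ∩ A = ↑(A.filter fun e => v e = 1) := by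
    ext e
    have : e ∈ A → e ∈ K := @hA e
    simp only [positivePart, Set.mem_inter_iff, Set.mem_ofPred_eq, Finset.mem_coe,
      Finset.mem_filter]
    tauto
  have hv' : ∀ e, v e = 2 * (if v e = 1 then 1 else 0) - 1 := fun e => by
    rcases hv e with h | h <;> simp [h]
  rw [hset, Set.ncard_coe_finset, Finset.sum_congr rfl fun e _ => hv' e, Finset.sum_sub_distrib,
    ← Finset.mul_sum, Finset.sum_boole]
  simp

/-- The combinatorial form of a split matroid whose ground set is a union of two disjoint bases: the
inequality to which compatibility of the splits given by two flacets amounts. -/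
def HasCompatibleFlacets (M : Matroid α) : Prop :=
  ∀ F G, IsFlacet M F → IsFlacet M G → F ≠ G →
    (F ∩ G).ncard + M.rkNat M.E ≤ M.rkNat F + M.rkNat G

/-- The slack of `F` bounds the difference of the numbers of elements of `F` in a base and in its
complement if the complement is a base as well. -/
noncomputable def slack (M : Matroid α) (F : Finset α) : ℤ := 2 * M.rkNat F - F.card

lemma HasCompatibleFlacets.isSlackFamily [DecidableEq α] (hM : HasCompatibleFlacets M)
    (hB : IsBisectingBase M B) {K : Finset α} (hK : (K : Set α) = M.E) :
    IsSlackFamily K {F | IsFlacet M (F : Set α)} (slack M) := by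
  have hsub : ∀ F : Finset α, IsFlacet M (F : Set α) → F ⊆ K := fun F hF =>
    Finset.coe_subset.1 (hK ▸ hF.subset_ground)
  refine ⟨fun F hF => hsub F hF, fun F hF => ?_, fun F _ => ?_, fun F hF G hG hne => ?_⟩
  · have hle := hB.ncard_le hF.subset_ground
    rw [Set.ncard_coe_finset] at hle
    unfold slack
    omega
  · unfold slack
    omega
  · have hle := hM F G hF hG fun h => hne (Finset.coe_injective h)
    have hcard := hB.ncard_eq (isSeparator_ground M)
    rw [← Finset.coe_inter, Set.ncard_coe_finset] at hle
    rw [← hK, Set.ncard_coe_finset, hK] at hcard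
    have hunion := Finset.card_union_add_card_inter F G
    have hsdiff := Finset.card_sdiff_add_card_eq_card (Finset.union_subset (hsub F hF) (hsub G hG))
    unfold slack
    omega

lemma IsBalanced.isBase_positivePart [DecidableEq α] (hM : IsConnected M)
    (hB : IsBisectingBase M B) {K X : Finset α} (hK : (K : Set α) = M.E) (hX : X ⊆ K)
    {v : α → ℤ} (hv : IsBalanced K X v)
    (h : ∀ F : Finset α, IsFlacet M (F : Set α) → ∑ e ∈ F, v e ≤ slack M F) :
    M.IsBase (positivePart M.E v) := by
  have hsub : positivePart M.E v ⊆ M.E := Set.sep_subset _ _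
  have hcard : (positivePart M.E v).ncard = M.rkNat M.E := by
    have hpos := hv.isSign.ncard_positivePart_inter hK.subset
    have hE := hB.ncard_eq (isSeparator_ground M)
    rw [hv.sum_ground hX, hK, Set.inter_eq_left.2 hsub] at hpos
    rw [← hK, Set.ncard_coe_finset, hK] at hE
    omega
  refine isBase_of_ncard_eq_rkNat ?_ hcard
  by_contra hdep
  obtain ⟨F, hF, hlt⟩ := exists_isFlacet_rkNat_lt_ncard_inter hM hsub hcard hdep
  lift F to Finset α using M.ground_finite.subset hF.subset_ground
  have hpos := hv.isSign.ncard_positivePart_inter hF.subset_ground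
  have hle := h F hF
  unfold slack at hle
  omega

lemma HasCompatibleFlacets.exists_isBisectingBase_of_even (hM : HasCompatibleFlacets M)
    (hMc : IsConnected M) (hB : IsBisectingBase M B) (hX : X ⊆ M.E) (hXe : Even X.ncard) :
    ∃ C, IsBisectingBase M C ∧ 2 * (C ∩ X).ncard = X.ncard := by
  classical
  obtain ⟨K, hK⟩ := M.ground_finite.exists_finset_coe
  lift X to Finset α using M.ground_finite.subset hX
  have hXK : X ⊆ K := Finset.coe_subset.1 (hK ▸ hX)
  have hcard := hB.ncard_eq (isSeparator_ground M)
  rw [← hK, Set.ncard_coe_finset] at hcard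
  rw [Set.ncard_coe_finset] at hXe
  have hsdiff := Finset.card_sdiff_add_card_eq_card hXK
  have hKX : Even (K \ X).card := by
    rw [Nat.even_iff] at hXe ⊢
    omega
  obtain ⟨v, hv, hslack⟩ :=
    (hM.isSlackFamily hB hK).exists_isBalanced_forall_abs_sum_le hXK hXe hKX
  refine ⟨positivePart M.E v, ⟨?_, ?_⟩, ?_⟩
  · exact hv.isBase_positivePart hMc hB hK hXK fun F hF => (abs_le.1 (hslack F hF)).2
  · rw [hv.isSign.sdiff_positivePart]
    refine hv.neg.isBase_positivePart hMc hB hK hXK fun F hF => ?_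
    simpa using neg_le.1 (abs_le.1 (hslack F hF)).1
  · have hpos := hv.isSign.ncard_positivePart_inter hX
    rw [hv.sum_left] at hpos
    rw [Set.ncard_coe_finset]
    omega

lemma HasCompatibleFlacets.isEquitable (hM : HasCompatibleFlacets M) (hMc : IsConnected M)
    (hB : IsBisectingBase M B) : M.IsEquitable := by
  intro X hX
  have hXfin := M.ground_finite.subset hX
  rcases Nat.even_or_odd X.ncard with hXe | hXo
  · obtain ⟨C, hC, hCX⟩ := hM.exists_isBisectingBase_of_even hMc hB hX hXe
    exact ⟨C, hC.isBase, hC.isBase_compl, by omega, by omega⟩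
  · obtain ⟨x, hxE, hxX⟩ : ∃ x ∈ M.E, x ∉ X := by
      by_contra! h
      rw [hX.antisymm h, hB.ncard_eq (isSeparator_ground M), ← Nat.not_even_iff_odd] at hXo
      exact hXo (even_two_mul _)
    have hcard := Set.ncard_insert_of_notMem hxX hXfin
    obtain ⟨C, hC, hCX⟩ := hM.exists_isBisectingBase_of_even hMc hB
      (Set.insert_subset hxE hX) (hcard ▸ hXo.add_one)
    have hadd := ncard_inter_add_ncard_inter_sdiff hC.isBase.finite (Set.subset_insert x X)
    have hle : (C ∩ (insert x X \ X)).ncard ≤ 1 := by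
      rw [Set.insert_sdiff_of_notMem _ hxX, Set.sdiff_self, insert_empty_eq]
      exact (Set.ncard_le_ncard Set.inter_subset_right).trans_eq (Set.ncard_singleton x)
    exact ⟨C, hC.isBase, hC.isBase_compl, by omega, by omega⟩

lemma IsSeparator.isBisectingBase_union (hK : IsSeparator M K)
    (hB : IsBisectingBase (M ↾ K) B) (hC : IsBisectingBase (M ↾ (M.E \ K)) C) :
    IsBisectingBase M (B ∪ C) := by
  have hBK : B ⊆ K := hB.isBase.subset_ground
  have hCK : C ⊆ M.E \ K := hC.isBase.subset_ground
  refine ⟨hK.isBase_union hB.isBase hC.isBase, ?_⟩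
  convert hK.isBase_union hB.isBase_compl hC.isBase_compl using 1
  simp only [Matroid.restrict_ground_eq]
  grind [hK.1]

/-- Of the two rounding errors for `X ∩ K` and `X \ K`, one can be reversed by passing to the
complementary base, so that they cancel. -/
lemma IsSeparator.isEquitable (hK : IsSeparator M K) (h : (M ↾ K).IsEquitable)
    (h' : (M ↾ (M.E \ K)).IsEquitable) : M.IsEquitable := by
  intro X hX
  have hXfin := M.ground_finite.subset hX
  obtain ⟨B, hB, hB', hBX, hBX'⟩ := h (X ∩ K) Set.inter_subset_right
  obtain ⟨C, hC, hC', hCX, hCX'⟩ := h' (X \ K) (Set.sdiff_subset_sdiff_left hX)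
  have : (M ↾ (M.E \ K)).Finite := Matroid.restrict_finite M.ground_finite.sdiff
  have hBb : IsBisectingBase (M ↾ K) B := ⟨hB, hB'⟩
  have hCb : IsBisectingBase (M ↾ (M.E \ K)) C := ⟨hC, hC'⟩
  have hX' : X \ K ⊆ (M ↾ (M.E \ K)).E := Set.sdiff_subset_sdiff_left hX
  have hcard := Set.ncard_inter_add_ncard_sdiff_eq_ncard X K hXfin
  have hCcard := hCb.ncard_inter_add_ncard_inter hX'
  have hinter : ∀ D ⊆ M.E \ K, ((B ∪ D) ∩ X).ncard =
      (B ∩ (X ∩ K)).ncard + (D ∩ (X \ K)).ncard := by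
    intro D hD
    have hBK : B ⊆ K := hB.subset_ground
    rw [← Set.ncard_union_eq (by grind) ((hXfin.inter_of_left K).inter_of_right B)
      (hXfin.sdiff.inter_of_right D)]
    congr 1
    grind
  have hinterC := hinter C hC.subset_ground
  have hinterC' := hinter _ hC'.subset_ground
  by_cases hgood : X.ncard / 2 ≤ ((B ∪ C) ∩ X).ncard ∧ ((B ∪ C) ∩ X).ncard ≤ (X.ncard + 1) / 2
  · have hBC := hK.isBisectingBase_union hBb hCb
    exact ⟨B ∪ C, hBC.isBase, hBC.isBase_compl, hgood⟩
  · have hBC := hK.isBisectingBase_union hBb hCb.compl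
    exact ⟨_, hBC.isBase, hBC.isBase_compl, by omega, by omega⟩

lemma IsBisectingBase.restrict (hB : IsBisectingBase M B) (hK : IsSeparator M K) :
    IsBisectingBase (M ↾ K) (B ∩ K) := by
  refine ⟨hK.isBase_inter hB.isBase, ?_⟩
  convert hK.isBase_inter hB.isBase_compl using 1
  rw [Matroid.restrict_ground_eq]
  grind [hK.1]

lemma hasCompatibleFlacets_restrict (hM : M.IsSplit) (hB : IsBisectingBase M B)
    (hK : IsSeparator M K) (hKc : IsConnected (M ↾ K)) : HasCompatibleFlacets (M ↾ K) := by
  intro F G hF hG hne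
  rw [rkNat_restrict_ground, rkNat_restrict M (show F ⊆ K from hF.subset_ground),
    rkNat_restrict M (show G ⊆ K from hG.subset_ground)]
  exact ncard_inter_add_rkNat_le hM hB hK hKc hF hG hne

lemma isEquitable_of_forall_isConnected_restrict
    (h : ∀ K, IsSeparator M K → IsConnected (M ↾ K) → (M ↾ K).IsEquitable) : M.IsEquitable := by
  suffices hsep : ∀ n, ∀ K, IsSeparator M K → K.ncard = n → (M ↾ K).IsEquitable by
    simpa using hsep _ M.E (isSeparator_ground M) rfl
  intro n
  induction n using Nat.strong_induction_on with
  | _ n ih =>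
  rintro K hK rfl
  by_cases hKc : IsConnected (M ↾ K)
  · exact h K hK hKc
  simp only [IsConnected] at hKc
  push Not at hKc
  obtain ⟨A, hA, hA₀, hAK⟩ := hKc
  have hKfin := M.ground_finite.subset hK.1
  have : (M ↾ K).Finite := Matroid.restrict_finite hKfin
  have hsub : A ⊆ K := hA.1
  have hlt : A.ncard < K.ncard := Set.ncard_lt_ncard (hsub.ssubset_of_ne hAK) hKfin
  have hlt' : (K \ A).ncard < K.ncard := Set.ncard_lt_ncard
    (Set.sdiff_ssubset_left_iff.2 (by rwa [Set.inter_eq_right.2 hsub])) hKfin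
  refine hA.isEquitable ?_ ?_
  · rw [Matroid.restrict_restrict_eq _ hsub]
    exact ih _ hlt A (hK.of_restrict hA) rfl
  · rw [Matroid.restrict_ground_eq, Matroid.restrict_restrict_eq _ Set.sdiff_subset]
    exact ih _ hlt' (K \ A) (hK.of_restrict hA.compl) rfl

end Equitable

end SplitMatroid

open SplitMatroid

theorem corollary3p5 {α : Type*} (M : Matroid α) [M.Finite] (hM : M.IsSplit)
    (hpart : ∃ B₁ B₂, M.IsBase B₁ ∧ M.IsBase B₂ ∧ Disjoint B₁ B₂ ∧ B₁ ∪ B₂ = M.E) :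
    M.IsEquitable := by
  obtain ⟨B, B', hB, hB', hdisj, hunion⟩ := hpart
  have hcompl : M.E \ B = B' := by rw [← hunion, Set.union_sdiff_cancel_left hdisj.le_bot]
  have hbisect : IsBisectingBase M B := ⟨hB, hcompl ▸ hB'⟩
  refine isEquitable_of_forall_isConnected_restrict fun K hK hKc => ?_
  have : (M.restrict K).Finite := Matroid.restrict_finite (M.ground_finite.subset hK.1)
  exact (hasCompatibleFlacets_restrict hM hbisect hK hKc).isEquitable hKc (hbisect.restrict hK)
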